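/- **Setting.** Let $\Lambda=\mathbb T^3=(\mathbb R/2\pi\mathbb Z)^3$ with normalized Haar measure. A density matrix of order $k\ge 1$ is a function $\sigma^{(k)}\in L^2(\Lambda^k\times\Lambda^k)$, with Fourier transform $\widehat\sigma^{(k)}(\xi_1,\dots,\xi_k;\xi_1',\dots,\xi_k')=\int \sigma^{(k)}(\vec x_k;\vec x_k')\,e^{-i\sum_j\langle x_j,\xi_j\rangle+i\sum_j\langle x_j',\xi_j'\rangle}\,d\vec x_k\,d\vec x_k'$, where $\xi_j,\xi_j'\in\mathbb Z^3$. With $\langle\zeta\rangle=\sqrt{1+|\zeta|^2}$, put $\|\sigma^{(k)}\|_{H^\alpha}=\big\|\prod_j\langle\xi_j\rangle^\alpha\langle\xi'_j\rangle^\alpha\,\widehat\sigma^{(k)}\big\|_{\ell^2}$. The free evolution is $\mathcal U^{(k)}(t)\sigma^{(k)}=e^{it\sum_j\Delta_{x_j}}\sigma^{(k)}e^{-it\sum_j\Delta_{x_j'}}$, i.e. the Fourier multiplier $e^{-it\sum_j(|\xi_j|^2-|\xi_j'|^2)}$. Let $(h_\zeta)_{\zeta\in\mathbb Z^3}$ be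 independent random variables on a probability space $(\Omega,p)$, each equal to $1$ or $-1$ with probability $\frac12$. Let $\Omega^*=\prod_{k\ge2}\Omega$ carry the product probability measure; its elements are $\omega^*=(\omega_2,\omega_3,\dots)$. For a random density matrix $\sigma^{(k+1)}\in L^2(\Omega^*;L^2(\Lambda^{k+1}\times\Lambda^{k+1}))$ and $1\le j\le k$, let $[B^{+}_{j,k+1}]^{\omega_{k+1}}\sigma^{(k+1)}$ and $[B^{-}_{j,k+1}]^{\omega_{k+1}}\sigma^{(k+1)}$ be the random density matrices of order $k$ whose Fourier transforms at $(\vec\xi_k;\vec\xi_k')$ are $$\sum_{a,b\in\mathbb Z^3}h_{\xi_j}h_{\xi_j-a+b}h_ah_b(\omega_{k+1})\,\widehat\sigma^{(k+1)}(\xi_1,\dots,\xi_j-a+b,\dots,\xi_k,a;\ \vec\xi_k',b),$$ $$\sum_{a,b\in\mathbb Z^3}h_{\xi_j'}h_{\xi_j'-b+a}h_ah_b(\omega_{k+1})\,\widehat\sigma^{(k+1)}(\vec\xi_k,a;\ \xi_1',\dots,\xi_j'-b+a,\dots,\xi_k',b),$$ respectively, the series being unconditionally convergent in $L^2(\Omega^*)$.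 Let $[B^{(k+1)}]^{\omega_{k+1}}=\sum_{j=1}^k\big([B^+_{j,k+1}]^{\omega_{k+1}}-[B^-_{j,k+1}]^{\omega_{k+1}}\big)$. For sequences $\Sigma=(\sigma^{(k)})_{k\ge1}$ put $\mathcal U(t)\Sigma=(\mathcal U^{(k)}(t)\sigma^{(k)})_k$ and $[\widehat B]^{\omega^*}\Sigma=([B^{(k+1)}]^{\omega_{k+1}}\sigma^{(k+1)})_k$. For deterministic, respectively random, sequences put $$\|\Sigma\|_{\mathcal H^\alpha_\xi}=\sum_{k\ge1}\xi^k\|\sigma^{(k)}\|_{H^\alpha},\qquad \|\Sigma\|_{L^2(\Omega^*)\mathcal H^\alpha_\xi}=\sum_{k\ge1}\xi^k\big\|\,\|\sigma^{(k)}\|_{H^\alpha}\big\|_{L^2(\Omega^*)}.$$ **Theorem 3.16.** There is a universal constant $\widetilde C_2>0$ and, for all $\alpha_0>\alpha>\frac34$, a constant $\widetilde C_1=\widetilde C_1(\alpha,\alpha_0)>0$ such that the following holds. Let $0<\xi<\xi'$ and $T>0$ satisfy $\frac{\widetilde C_1T}{\xi'}<1$ and $\frac{\widetilde C_2\xi}{\xi'}<1$,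 put $I=[0,T]$, and let $\Gamma(0)=(\gamma_0^{(k)})_k\in\mathcal H^{\alpha_0}_{\xi'}$ be deterministic. Then there is $[\Gamma]^{\omega^*}=([\gamma^{(k)}]^{\omega^*})_k\in C_{t\in I}L^2(\Omega^*)\mathcal H^\alpha_\xi$ (finite norm at every $t\in I$, and continuous on $I$ with respect to this norm) such that $[\widehat B]^{\omega^*}[\Gamma]^{\omega^*}(t)$ is defined for every $t\in I$, the Duhamel integrals below converge absolutely in $L^2(\Omega^*)H^\alpha$ in each component, and, for all $t\in I$ and all $\xi_0>0$, $$\Big\|[\Gamma]^{\omega^*}(t)-\mathcal U(t)\Gamma(0)+i\int_0^t\mathcal U(t-s)\,[\widehat B]^{\omega^*}[\Gamma]^{\omega^*}(s)\,ds\Big\|_{L^2(\Omega^*)\mathcal H^\alpha_{\xi_0}}=0 .$$ In particular, for all $t\in I$ and all $k\ge1$, the $k$-th component of this expression has zero $L^2(\Omega^*)H^\alpha(\Lambda^k\times\Lambda^k)$ norm. Moreover, there is a constant $M$ depending only on $\xi,\xi',\alpha,\alpha_0$ such that $$\big\|[\Gamma]^{\omega^*}\big\|_{L^\infty_{t\in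 I}L^2(\Omega^*)\mathcal H^\alpha_\xi}\le M\,\|\Gamma(0)\|_{\mathcal H^\alpha_{\xi'}} .$$ -/

import Mathlib

open MeasureTheory ProbabilityTheory Filter Topology Set
open scoped ENNReal NNReal

noncomputable section

namespace RandomGP

/-! ### Frequencies and density matrices on the torus

The spatial domain is `Λ = 𝕋³ = (ℝ / 2πℤ)³` with normalized Haar measure. It is parametrized by
`x = 2 π y` with `y` in Mathlib's unit torus, so that the monomial of frequency `n` is
`exp (2 π i n · y) = exp (i n · x)`; derivatives are taken in the variable `x`. -/

/-- Frequencies of `Λ = 𝕋³`. -/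
abbrev Freq : Type := Fin 3 → ℤ

/-- Coordinates on `Λ^k × Λ^k`: `Sum.inl (j, i)` is the `i`-th coordinate of `x_j` and
`Sum.inr (j, i)` is the `i`-th coordinate of `x'_j`. -/
abbrev Coord (k : ℕ) : Type := (Fin k × Fin 3) ⊕ (Fin k × Fin 3)

/-- Normalized Haar measure on `Λ^k × Λ^k`. -/
abbrev torusMeasure (k : ℕ) : Measure (UnitAddTorus (Coord k)) :=
  Measure.pi fun _ : Coord k => (AddCircle.haarAddCircle : Measure UnitAddCircle)

/-- Square integrable density matrices of order `k`, i.e. `L²(Λ^k × Λ^k)`. -/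
abbrev DensityMatrix (k : ℕ) : Type := Lp ℂ 2 (torusMeasure k)

/-- The trigonometric monomials as a Hilbert basis of `L²(Λ^k × Λ^k)`. -/
def monomialBasis (k : ℕ) : HilbertBasis (Coord k → ℤ) ℂ (DensityMatrix k) :=
  UnitAddTorus.mFourierBasis

/-- The integer vector `(ξ, - ξ')` on `Λ^k × Λ^k`. -/
def modeVec {k : ℕ} (ξ ξ' : Fin k → Freq) : Coord k → ℤ :=
  Sum.elim (fun p => ξ p.1 p.2) (fun p => -ξ' p.1 p.2)

/-- The Fourier transform of a density matrix,
`σ̂(ξ; ξ') = ∫ σ(x; x') exp (-i ∑ ⟨x_j, ξ_j⟩ + i ∑ ⟨x'_j, ξ'_j⟩) dx dx'`. -/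
def DensityMatrix.hat {k : ℕ} (σ : DensityMatrix k) (ξ ξ' : Fin k → Freq) : ℂ :=
  UnitAddTorus.mFourierCoeff (σ : UnitAddTorus (Coord k) → ℂ) (modeVec ξ ξ')

/-- `|ζ|²` for a frequency `ζ`. -/
def freqSq (ζ : Freq) : ℝ := ∑ i, (ζ i : ℝ) ^ 2

/-- The Japanese bracket `⟨ζ⟩ = √(1 + |ζ|²)`. -/
def bracket (ζ : Freq) : ℝ := Real.sqrt (1 + freqSq ζ)

/-- The Fourier symbol of `S^{(k,α)}`. -/
def weight {k : ℕ} (α : ℝ) (ξ ξ' : Fin k → Freq) : ℝ :=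
  (∏ j, bracket (ξ j) ^ α) * ∏ j, bracket (ξ' j) ^ α

/-- `‖σ‖_{H^α} = ‖S^{(k,α)} σ‖_{L²(Λ^k × Λ^k)}`, computed on the Fourier side (Plancherel); it is
`∞` when `σ` is not in `H^α`. -/
def sobolevNorm {k : ℕ} (α : ℝ) (σ : DensityMatrix k) : ℝ≥0∞ :=
  (∑' m : (Fin k → Freq) × (Fin k → Freq),
    (ENNReal.ofReal (weight α m.1 m.2) * ‖σ.hat m.1 m.2‖ₑ) ^ 2) ^ (1 / 2 : ℝ)

/-! ### The free evolution -/

/-- The multiplier `exp (-i t (|ξ|² - |ξ'|²))`, as a function of the integer vector `(ξ, -ξ')`. -/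
def phase (k : ℕ) (t : ℝ) (n : Coord k → ℤ) : ℂ :=
  Complex.exp (-(Complex.I * t * (((∑ p, (n (Sum.inl p) : ℝ) ^ 2) -
    ∑ p, (n (Sum.inr p) : ℝ) ^ 2 : ℝ) : ℂ)))

theorem norm_phase (k : ℕ) (t : ℝ) (n : Coord k → ℤ) : ‖phase k t n‖ = 1 := by
  rw [phase, Complex.norm_exp]
  simp [-Complex.ofReal_sub, -Complex.ofReal_sum]

theorem orthonormal_phase (k : ℕ) (t : ℝ) :
    Orthonormal ℂ fun n => phase k t n • monomialBasis k n := by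
  refine ⟨fun n => ?_, fun m n hmn => ?_⟩
  · rw [norm_smul, norm_phase, (monomialBasis k).orthonormal.1 n, one_mul]
  · change inner ℂ (phase k t m • monomialBasis k m) (phase k t n • monomialBasis k n) = 0
    rw [inner_smul_left, inner_smul_right, (monomialBasis k).orthonormal.2 hmn]
    simp

theorem phase_span (k : ℕ) (t : ℝ) :
    (Submodule.span ℂ (Set.range fun n => phase k t n • monomialBasis k n))ᗮ = ⊥ := by
  rw [Submodule.eq_bot_iff]
  intro x hx
  apply (monomialBasis k).repr.injective
  ext n
  rw [map_zero, HilbertBasis.repr_apply_apply]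
  have h := (Submodule.mem_orthogonal _ x).1 hx _
    (Submodule.subset_span (Set.mem_range_self n))
  rw [inner_smul_left] at h
  have hne : phase k t n ≠ 0 := by
    intro h0
    have := norm_phase k t n
    simp [h0] at this
  simpa [hne] using h

/-- The Hilbert basis of evolved monomials. -/
def evolvedBasis (k : ℕ) (t : ℝ) : HilbertBasis (Coord k → ℤ) ℂ (DensityMatrix k) :=
  HilbertBasis.mkOfOrthogonalEqBot (orthonormal_phase k t) (phase_span k t)

/-- The free evolution `𝒰^{(k)}(t) σ = exp (i t ∑ Δ_{x_j}) σ exp (- i t ∑ Δ_{x'_j})`: the unitary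
operator that sends each monomial `e_n` to `phase n • e_n`. -/
def freeEvolution (k : ℕ) (t : ℝ) : DensityMatrix k ≃ₗᵢ[ℂ] DensityMatrix k :=
  (monomialBasis k).repr.trans (evolvedBasis k t).repr.symm

/-- On the Fourier side the free evolution is multiplication by `exp (-i t (|ξ|² - |ξ'|²))`. -/
theorem hat_freeEvolution {k : ℕ} (t : ℝ) (σ : DensityMatrix k) (ξ ξ' : Fin k → Freq) :
    DensityMatrix.hat (freeEvolution k t σ) ξ ξ' =
      Complex.exp (-(Complex.I * t * (((∑ j, freqSq (ξ j)) - ∑ j, freqSq (ξ' j) : ℝ) : ℂ))) *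
        σ.hat ξ ξ' := by
  have hrepr : ∀ (τ : DensityMatrix k) n, UnitAddTorus.mFourierCoeff
      (τ : UnitAddTorus (Coord k) → ℂ) n = (monomialBasis k).repr τ n := fun τ n =>
    (UnitAddTorus.mFourierBasis_repr τ n).symm
  have hev : ∀ n, evolvedBasis k t n = phase k t n • monomialBasis k n := fun n => by
    simp [evolvedBasis]
  have key : ∀ n, (monomialBasis k).repr (freeEvolution k t σ) n =
      phase k t n * (monomialBasis k).repr σ n := by
    intro n
    have h1 : (evolvedBasis k t).repr (freeEvolution k t σ) n = (monomialBasis k).repr σ n := by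
      simp [freeEvolution]
    rw [HilbertBasis.repr_apply_apply, hev, inner_smul_left] at h1
    rw [← h1, ← mul_assoc, Complex.mul_conj, Complex.normSq_eq_norm_sq, norm_phase,
      HilbertBasis.repr_apply_apply]
    simp
  rw [DensityMatrix.hat, DensityMatrix.hat, hrepr, hrepr, key]
  congr 1
  simp [phase, modeVec, freqSq, Fintype.sum_prod_type]

/-! ### Randomness -/

/-- Independent random variables `h_ζ`, `ζ ∈ ℤ³`, that take the values `1` and `-1` with
probability `1/2` each. -/
structure IsBernoulliFamily {Ω : Type*} [MeasurableSpace Ω] (μ : Measure Ω)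
    (h : Freq → Ω → ℝ) : Prop where
  measurable : ∀ ζ, Measurable (h ζ)
  prob_one : ∀ ζ, μ {ω | h ζ ω = 1} = 1 / 2
  prob_neg_one : ∀ ζ, μ {ω | h ζ ω = -1} = 1 / 2
  indep : iIndepFun h μ

/-- `Ω* = ∏_{k ≥ 2} Ω`, whose elements are the sequences `ω* = (ω₂, ω₃, …)`. -/
abbrev OmegaStar (Ω : Type*) : Type _ := {k : ℕ // 2 ≤ k} → Ω

/-- The infinite product probability measure on `Ω*`. -/
abbrev pStar {Ω : Type*} [MeasurableSpace Ω] (μ : Measure Ω) [IsProbabilityMeasure μ] :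
    Measure (OmegaStar Ω) :=
  Measure.infinitePi fun _ => μ

/-- Random density matrices of order `k`, i.e. `L²(Ω*; L²(Λ^k × Λ^k))`. -/
abbrev RandomDM {Ω : Type*} [MeasurableSpace Ω] (μ : Measure Ω) [IsProbabilityMeasure μ]
    (k : ℕ) : Type _ :=
  Lp (DensityMatrix k) 2 (pStar μ)

section Random

variable {Ω : Type*} [MeasurableSpace Ω] {μ : Measure Ω} [IsProbabilityMeasure μ]

/-- `‖σ‖_{L²(Ω*) H^α}`: the `L²(Ω*)` norm of `ω* ↦ ‖σ(ω*)‖_{H^α}`. -/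
def randomSobolevNorm {k : ℕ} (α : ℝ) (σ : RandomDM μ k) : ℝ≥0∞ :=
  eLpNorm (fun ω => sobolevNorm α (σ ω)) 2 (pStar μ)

/-- A deterministic density matrix, seen as a random one. -/
def constRandom (μ : Measure Ω) [IsProbabilityMeasure μ] {k : ℕ} (σ : DensityMatrix k) :
    RandomDM μ k :=
  Lp.const 2 (pStar μ) σ

/-- The free evolution acting on random density matrices, for each `ω*` separately. -/
def randomFreeEvolution {k : ℕ} (t : ℝ) (σ : RandomDM μ k) : RandomDM μ k :=
  ((freeEvolution k t).toContinuousLinearEquiv :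
    DensityMatrix k →L[ℂ] DensityMatrix k).compLp σ

/-! ### The randomized collision operator

For `k ≥ 1` the operator `[B_{j,k+1}^±]^{ω_{k+1}}` maps density matrices of order `k + 1` to density
matrices of order `k`; it is defined mode by mode, by a double series over the frequencies
`a = ξ_{k+1}` and `b = ξ'_{k+1}`. These series need not converge for each fixed `ω*` (they are not
absolutely convergent at low regularity): they are unconditionally convergent series in `L²(Ω*)`. -/

/-- The term of index `(a, b)` in the series for `([B_{j,k+1}^+]^{ω_{k+1}} σ)^(ξ; ξ')`. -/
def plusTerm {k : ℕ} (hk : 1 ≤ k) (h : Freq → Ω → ℝ) (j : Fin k) (σ : RandomDM μ (k + 1))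
    (ξ ξ' : Fin k → Freq) (ab : Freq × Freq) (ω : OmegaStar Ω) : ℂ :=
  let w : Ω := ω ⟨k + 1, Nat.succ_le_succ hk⟩
  ((h (ξ j) w * h (ξ j - ab.1 + ab.2) w * h ab.1 w * h ab.2 w : ℝ) : ℂ) *
    DensityMatrix.hat (σ ω)
      (Fin.snoc (α := fun _ => Freq) (Function.update ξ j (ξ j - ab.1 + ab.2)) ab.1)
      (Fin.snoc (α := fun _ => Freq) ξ' ab.2)

/-- The term of index `(a, b)` in the series for `([B_{j,k+1}^-]^{ω_{k+1}} σ)^(ξ; ξ')`. -/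
def minusTerm {k : ℕ} (hk : 1 ≤ k) (h : Freq → Ω → ℝ) (j : Fin k) (σ : RandomDM μ (k + 1))
    (ξ ξ' : Fin k → Freq) (ab : Freq × Freq) (ω : OmegaStar Ω) : ℂ :=
  let w : Ω := ω ⟨k + 1, Nat.succ_le_succ hk⟩
  ((h (ξ' j) w * h (ξ' j - ab.2 + ab.1) w * h ab.1 w * h ab.2 w : ℝ) : ℂ) *
    DensityMatrix.hat (σ ω)
      (Fin.snoc (α := fun _ => Freq) ξ ab.1)
      (Fin.snoc (α := fun _ => Freq) (Function.update ξ' j (ξ' j - ab.2 + ab.1)) ab.2)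

/-- `τ` is the random density matrix whose Fourier transform at each `(ξ; ξ')` is the sum of the
series `∑_{(a,b)} term ξ ξ' (a,b)`, unconditionally convergent in `L²(Ω*)`. -/
def HasFourierSeries {k : ℕ}
    (term : (Fin k → Freq) → (Fin k → Freq) → Freq × Freq → OmegaStar Ω → ℂ)
    (τ : RandomDM μ k) : Prop :=
  ∀ ξ ξ' : Fin k → Freq,
    Tendsto (fun F : Finset (Freq × Freq) =>
      eLpNorm (fun ω => (∑ ab ∈ F, term ξ ξ' ab ω) - DensityMatrix.hat (τ ω) ξ ξ') 2 (pStar μ))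
      atTop (𝓝 0)

/-- `τ = [B^{(k+1)}]^{ω_{k+1}} σ = ∑_j ([B_{j,k+1}^+]^{ω_{k+1}} σ - [B_{j,k+1}^-]^{ω_{k+1}} σ)`,
where every one of the operators on the right is defined at `σ`. -/
def IsCollision {k : ℕ} (hk : 1 ≤ k) (h : Freq → Ω → ℝ) (σ : RandomDM μ (k + 1))
    (τ : RandomDM μ k) : Prop :=
  ∃ τp τm : Fin k → RandomDM μ k,
    (∀ j, HasFourierSeries (plusTerm hk h j σ) (τp j)) ∧
    (∀ j, HasFourierSeries (minusTerm hk h j σ) (τm j)) ∧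
    τ = ∑ j, (τp j - τm j)

end Random

/-! ### Sequences of density matrices

A sequence `(σ^{(k)})_{k ≥ 1}` is stored with its component of order `k = n + 1` at index `n`. -/

/-- Deterministic sequences of density matrices. -/
abbrev DMSeq : Type := (n : ℕ) → DensityMatrix (n + 1)

/-- Random sequences of density matrices. -/
abbrev RandomDMSeq {Ω : Type*} [MeasurableSpace Ω] (μ : Measure Ω) [IsProbabilityMeasure μ] :
    Type _ :=
  (n : ℕ) → RandomDM μ (n + 1)

/-- `‖Σ‖_{ℋ_ξ^α} = ∑_{k ≥ 1} ξ^k ‖σ^{(k)}‖_{H^α}`. -/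
def hierarchyNorm (α ξ : ℝ) (Γ : DMSeq) : ℝ≥0∞ :=
  ∑' n : ℕ, ENNReal.ofReal (ξ ^ (n + 1)) * sobolevNorm α (Γ n)

section Random

variable {Ω : Type*} [MeasurableSpace Ω] {μ : Measure Ω} [IsProbabilityMeasure μ]

/-- `‖Σ‖_{L²(Ω*) ℋ_ξ^α} = ∑_{k ≥ 1} ξ^k ‖σ^{(k)}‖_{L²(Ω*) H^α}`. -/
def randomHierarchyNorm (α ξ : ℝ) (Γ : RandomDMSeq μ) : ℝ≥0∞ :=
  ∑' n : ℕ, ENNReal.ofReal (ξ ^ (n + 1)) * randomSobolevNorm α (Γ n)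

/-- `‖Σ‖_{L^∞_{t ∈ [0,T]} L²(Ω*) ℋ_ξ^α}`. -/
def linftyHierarchyNorm (T α ξ : ℝ) (Γ : ℝ → RandomDMSeq μ) : ℝ≥0∞ :=
  essSup (fun t => randomHierarchyNorm α ξ (Γ t)) (volume.restrict (Icc 0 T))

/-- `Γ ∈ C_{t ∈ [0,T]} L²(Ω*) ℋ_ξ^α`: `Γ(t)` lies in `L²(Ω*) ℋ_ξ^α` for every `t ∈ [0,T]` and depends
continuously on `t` in its norm. -/
def IsContinuousInTime (T α ξ : ℝ) (Γ : ℝ → RandomDMSeq μ) : Prop :=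
  (∀ t ∈ Icc 0 T, randomHierarchyNorm α ξ (Γ t) < ∞) ∧
  ∀ t₀ ∈ Icc 0 T, Tendsto (fun t => randomHierarchyNorm α ξ (Γ t - Γ t₀))
    (𝓝[Icc 0 T] t₀) (𝓝 0)

/-- `β(t) = [B̂]^{ω*} Γ(t) = ([B^{(k+1)}]^{ω_{k+1}} γ^{(k+1)}(t))_k` for all `t ∈ [0,T]`, and for
each `t ∈ [0,T]` and each component the integral `∫_0^t 𝒰(t-s) β(s) ds` converges absolutely: the
integrand is Bochner integrable, and its `L²(Ω*) H^α` norm, which by unitarity of `𝒰` is that of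
`β(s)`, is integrable. -/
def IsCollisionPath (h : Freq → Ω → ℝ) (T α : ℝ) (Γ β : ℝ → RandomDMSeq μ) : Prop :=
  (∀ t ∈ Icc 0 T, ∀ n : ℕ, IsCollision (Nat.succ_pos n) h (Γ t (n + 1)) (β t n)) ∧
  (∀ t ∈ Icc 0 T, ∀ n : ℕ,
    IntervalIntegrable (fun s => randomFreeEvolution (t - s) (β s n)) volume 0 t) ∧
  ∀ n : ℕ, ∫⁻ s in Icc 0 T, randomSobolevNorm α (β s n) < ∞

/-- The sequence `Γ(t) - 𝒰(t) Γ(0) + i ∫_0^t 𝒰(t-s) β(s) ds`. -/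
def duhamelDefect (Γ₀ : DMSeq) (Γ β : ℝ → RandomDMSeq μ) (t : ℝ) : RandomDMSeq μ := fun n =>
  Γ t n - constRandom μ (freeEvolution (n + 1) t (Γ₀ n)) +
    Complex.I • ∫ s in (0 : ℝ)..t, randomFreeEvolution (t - s) (β s n)

end Random

end RandomGP

end

/-! The solution is the Duhamel series, and what makes it converge is that the randomized collision
operators are bounded without loss of derivatives on the random densities that actually occur.

Let `W_s` be the product of the signs `h_ζ (ω_l)` over a finite set `s` of sites `(l, ζ)`.
Independence makes the fields `W_s ⊗ e_m` orthonormal in `L²(Ω*; L²)`. Deterministic data only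
involve `s = ∅`, and a collision into order `k` multiplies by signs of level `k + 1`. Hence all
terms of order `k` of the expansion live on patterns `s` with levels above `k`, and the whole
problem can be moved to `ℓ²` over pairs (pattern, mode); `embed` carries it back, turning the `ℓ²`
norm into the `L²(Ω*) H^α` norm (`randomSobolevNorm_embed`).

On this space each `B^±` sends a basis vector to a multiple of a basis vector. The signs of level `k
+ 1` are fresh: they do not occur in the pattern of the input, so the pattern of the output
determines both the input pattern and the set `D` of frequencies occurring an odd number of times
among `ζ`, `ζ - a + b`, `a`, `b` (`CollisionKernel.fibreBound`). The operator norm is therefore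
controlled by the squared quotients of weights summed over the pairs `(a, b)` with the same `D`
(`exists_tsum_ratio_le`). If `D = ∅`, then `a = b` or `a = ζ`, and the sum is at most two copies of
`∑ ⟨a⟩^(-4α)`, finite because `4α > 3`. If `D ≠ ∅`, only boundedly many pairs remain, each with a
bounded quotient.

So `B^{(k+1)}` has norm at most `2 C k`. In the term with `m` collisions, the product of these norms
and the volume `t^m / m!` of the time simplex combine to a binomial coefficient
(`norm_duhamelTerm_le`); bounding it by a power of `2` gives both smallness conditions. -/

noncomputable section

namespace RandomGP

/-! ### Weighted composition operators on `ℓ²` -/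

/-- The Hilbert space `ℓ²(I)` of complex sequences. -/
abbrev LTwo (I : Type*) : Type _ := lp (fun _ : I => ℂ) 2

section LTwo

variable {I J : Type*}

lemma memLTwo_iff {f : I → ℂ} : Memℓp f 2 ↔ ∑' i, ‖f i‖ₑ ^ 2 < ∞ := by
  rw [memℓp_gen_iff (by norm_num)]
  have h : (∑' i, ‖f i‖ₑ ^ 2) = ∑' i, ((‖f i‖₊ ^ 2 : ℝ≥0) : ℝ≥0∞) := by
    simp [enorm_eq_nnnorm]
  rw [h, lt_top_iff_ne_top, ENNReal.tsum_coe_ne_top_iff_summable, ← NNReal.summable_coe]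
  simp

lemma LTwo.enorm_sq (f : LTwo I) : ‖f‖ₑ ^ 2 = ∑' i, ‖f i‖ₑ ^ 2 := by
  have h1 := lp.hasSum_norm (p := 2) (by norm_num) f
  have h2 : HasSum (fun i => ‖f i‖₊ ^ 2) (‖f‖₊ ^ 2) := by
    rw [← NNReal.hasSum_coe]
    simpa using h1
  have h3 := (ENNReal.hasSum_coe.2 h2).tsum_eq
  simpa [enorm_eq_nnnorm] using h3.symm

lemma LTwo.single_eq_smul [DecidableEq I] (i : I) (z : ℂ) :
    lp.single 2 i z = z • (lp.single 2 i (1 : ℂ) : LTwo I) := by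
  rw [← lp.single_smul]; simp

lemma LTwo.ext_single [DecidableEq I] {E : Type*} [NormedAddCommGroup E] [NormedSpace ℂ E]
    {F G : LTwo I →L[ℂ] E}
    (h : ∀ i, F (lp.single 2 i (1 : ℂ)) = G (lp.single 2 i (1 : ℂ))) : F = G := by
  refine lp.ext_continuousLinearMap (by norm_num) fun i => ?_
  ext
  simpa using h i

/-- The basis expansion of `f` converges unconditionally and `F` is continuous. This is the source
of the unconditional convergence of the collision series in `hasSum_termL`. -/
lemma LTwo.hasSum_map [DecidableEq I] {E : Type*} [NormedAddCommGroup E] [NormedSpace ℂ E]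
    (F : LTwo I →L[ℂ] E) (f : LTwo I) :
    HasSum (fun i => f i • F (lp.single 2 i (1 : ℂ))) (F f) := by
  have := (lp.hasSum_single (p := 2) (by norm_num) f).map F F.continuous
  refine this.congr_fun fun i => ?_
  rw [Function.comp_apply, LTwo.single_eq_smul i (f i), map_smul]

variable (φ : I → J) (c : I → ℂ) (C : ℝ≥0)

/-- The weights `c` are square summable along the fibres of `φ`, with norms at most `C`. -/
def FibreBound : Prop := 
  ∀ j, (∑' i, (φ ⁻¹' {j}).indicator (fun i => ‖c i‖ₑ ^ 2) i) ≤ (C : ℝ≥0∞) ^ 2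

variable {φ c C}

/-- Sorting the indices `i` by the value of `φ` (Tonelli), each `‖g j‖²` gets multiplied by the sum
of `‖c‖²` over one fibre. -/
lemma FibreBound.tsum_le (H : FibreBound φ c C) (g : J → ℂ) :
    ∑' i, ‖c i * g (φ i)‖ₑ ^ 2 ≤ (C : ℝ≥0∞) ^ 2 * ∑' j, ‖g j‖ₑ ^ 2 := by
  classical
  calc ∑' i, ‖c i * g (φ i)‖ₑ ^ 2
      = ∑' i, ∑' j, (φ ⁻¹' {j}).indicator (fun i => ‖c i‖ₑ ^ 2) i * ‖g j‖ₑ ^ 2 := by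
        refine tsum_congr fun i => ?_
        rw [tsum_eq_single (φ i) fun j hj => by simp [Set.indicator, hj.symm]]
        simp [enorm_mul, mul_pow]
    _ = ∑' j, (∑' i, (φ ⁻¹' {j}).indicator (fun i => ‖c i‖ₑ ^ 2) i) * ‖g j‖ₑ ^ 2 := by
        rw [ENNReal.tsum_comm]
        exact tsum_congr fun j => ENNReal.tsum_mul_right
    _ ≤ ∑' j, (C : ℝ≥0∞) ^ 2 * ‖g j‖ₑ ^ 2 := by
        gcongr with j
        exact H j
    _ = _ := ENNReal.tsum_mul_left

lemma FibreBound.memLTwo (H : FibreBound φ c C) (g : LTwo J) :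
    Memℓp (fun i => c i * g (φ i)) 2 := by
  rw [memLTwo_iff]
  refine (H.tsum_le g).trans_lt ?_
  rw [← LTwo.enorm_sq]
  finiteness

/-- The operator `g ↦ c · (g ∘ φ)`. -/
def weightedPullback (H : FibreBound φ c C) : LTwo J →L[ℂ] LTwo I :=
  LinearMap.mkContinuous
    { toFun := fun g => ⟨fun i => c i * g (φ i), H.memLTwo g⟩
      map_add' := fun f g => by ext i; exact mul_add _ _ _
      map_smul' := fun z g => by ext i; simp; ring }
    C fun g => by
      have h : ‖(⟨fun i => c i * g (φ i), H.memLTwo g⟩ : LTwo I)‖ₑ ≤ C * ‖g‖ₑ := by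
        rw [← ENNReal.pow_le_pow_left_iff two_ne_zero, mul_pow, LTwo.enorm_sq, LTwo.enorm_sq]
        exact H.tsum_le g
      rw [enorm_eq_nnnorm, enorm_eq_nnnorm, ← ENNReal.coe_mul, ENNReal.coe_le_coe] at h
      exact_mod_cast h

@[simp] lemma weightedPullback_apply (H : FibreBound φ c C) (g : LTwo J) (i : I) :
    weightedPullback H g i = c i * g (φ i) := rfl

lemma norm_weightedPullback_le (H : FibreBound φ c C) : ‖weightedPullback H‖ ≤ C :=
  LinearMap.mkContinuous_norm_le _ C.2 _

/-- The operator that sends the basis vector of index `i` to `conj (c i)` times the one of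
index `φ i`. -/
def weightedPushforward (H : FibreBound φ c C) : LTwo I →L[ℂ] LTwo J :=
  (weightedPullback H).adjoint

/-- Boundedness is proved for the pullback, which involves no infinite sum in any coordinate; the
adjoint has the same norm. -/
lemma norm_weightedPushforward_le (H : FibreBound φ c C) : ‖weightedPushforward H‖ ≤ C := by
  rw [weightedPushforward, LinearIsometryEquiv.norm_map]
  exact norm_weightedPullback_le H

lemma weightedPushforward_single [DecidableEq I] [DecidableEq J] (H : FibreBound φ c C) (i : I) :
    weightedPushforward H (lp.single 2 i (1 : ℂ)) =
      (starRingEnd ℂ (c i)) • lp.single 2 (φ i) (1 : ℂ) := by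
  refine ext_inner_right ℂ fun g => ?_
  rw [weightedPushforward, ContinuousLinearMap.adjoint_inner_left, inner_smul_left,
    lp.inner_single_left, lp.inner_single_left]
  simp

lemma FibreBound.of_id {c : I → ℂ} (h : ∀ i, ‖c i‖ ≤ 1) : FibreBound id c 1 := by
  intro j
  rw [tsum_eq_single j fun i hi => by simp [Set.indicator, hi]]
  have : ‖c j‖ₑ ≤ 1 := by
    rw [enorm_eq_nnnorm]
    exact_mod_cast h j
  simpa [Set.indicator] using pow_le_pow_left' this 2

/-- The multiplication operator with symbol `c` bounded by `1`. -/
def diagonal (c : I → ℂ) (h : ∀ i, ‖c i‖ ≤ 1) : LTwo I →L[ℂ] LTwo I :=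
  weightedPullback (FibreBound.of_id h)

lemma norm_diagonal_le (c : I → ℂ) (h : ∀ i, ‖c i‖ ≤ 1) : ‖diagonal c h‖ ≤ 1 := by
  exact (norm_weightedPullback_le (FibreBound.of_id h)).trans_eq NNReal.coe_one

@[simp] lemma diagonal_apply (c : I → ℂ) (h : ∀ i, ‖c i‖ ≤ 1) (f : LTwo I) (i : I) :
    diagonal c h f i = c i * f i := rfl

lemma diagonal_single [DecidableEq I] (c : I → ℂ) (h : ∀ i, ‖c i‖ ≤ 1) (i : I) :
    diagonal c h (lp.single 2 i (1 : ℂ)) = c i • lp.single 2 i (1 : ℂ) := by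
  ext j
  by_cases hj : j = i
  · subst hj; simp
  · simp [hj]

/-- Multiplication by phases that depend continuously on a parameter is strongly continuous. -/
lemma continuous_diagonal (c : ℝ → I → ℂ) (h : ∀ t i, ‖c t i‖ ≤ 1)
    (hc : ∀ i, Continuous fun t => c t i) (f : LTwo I) :
    Continuous fun t => diagonal (c t) (h t) f := by
  classical
  have hs : Summable fun i => ‖f i‖ ^ 2 := by
    simpa using (lp.memℓp f).summable (by norm_num)
  refine continuous_iff_continuousAt.2 fun t₀ => ?_
  rw [ContinuousAt, tendsto_iff_norm_sub_tendsto_zero]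
  have hn : ∀ t, ‖diagonal (c t) (h t) f - diagonal (c t₀) (h t₀) f‖ =
      √(∑' i, ‖(c t i - c t₀ i) * f i‖ ^ 2) := by
    intro t
    rw [lp.norm_eq_tsum_rpow (by norm_num), Real.sqrt_eq_rpow]
    simp [sub_mul]
  simp_rw [hn]
  rw [← Real.sqrt_zero]
  refine (Real.continuous_sqrt.tendsto 0).comp ?_
  have h0 : (0 : ℝ) = ∑' i, ‖(c t₀ i - c t₀ i) * f i‖ ^ 2 := by simp
  rw [h0]
  refine tendsto_tsum_of_dominated_convergence (bound := fun i => 2 ^ 2 * ‖f i‖ ^ 2)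
    (hs.mul_left _) (fun i => ?_) (Eventually.of_forall fun t i => ?_)
  · exact (((((hc i).sub continuous_const).mul continuous_const).norm.pow 2).tendsto t₀)
  · rw [norm_pow, norm_norm, norm_mul, mul_pow]
    gcongr
    calc ‖c t i - c t₀ i‖ ≤ ‖c t i‖ + ‖c t₀ i‖ := norm_sub_le _ _
      _ ≤ 2 := by linarith [h t i, h t₀ i]

end LTwo

/-! ### Linear hierarchies in Banach spaces

The Duhamel expansion of `x_n' = A_n x_n - i B_n x_{n+1}`, where `A_n` generates a group of
contractions and `‖B_n‖ ≤ C (n + 1)`. -/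

section Hierarchy

variable {H : ℕ → Type*} [∀ n, NormedAddCommGroup (H n)] [∀ n, NormedSpace ℂ (H n)]

/-- A strongly continuous family of contractions with the group law. -/
structure IsContractionGroup {E : Type*} [NormedAddCommGroup E] [NormedSpace ℂ E]
    (U : ℝ → E →L[ℂ] E) : Prop where
  norm_le : ∀ t x, ‖U t x‖ ≤ ‖x‖
  map_sub : ∀ t s x, U (t - s) x = U t (U (-s) x)
  continuous : ∀ x, Continuous fun t => U t x

/-- Split `U (τ t) (F t)` as `U (τ t) (F t₀) + U (τ t) (F t - F t₀)`: strong continuity handles the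
first part, contractivity the second. -/
lemma IsContractionGroup.continuousOn_apply {E : Type*} [NormedAddCommGroup E] [NormedSpace ℂ E]
    {U : ℝ → E →L[ℂ] E} (hU : IsContractionGroup U) {F : ℝ → E} {τ : ℝ → ℝ} {s : Set ℝ}
    (hτ : ContinuousOn τ s) (hF : ContinuousOn F s) : ContinuousOn (fun t => U (τ t) (F t)) s := by
  intro t₀ ht₀
  have h1 : Tendsto (fun t => U (τ t) (F t₀)) (𝓝[s] t₀) (𝓝 (U (τ t₀) (F t₀))) :=
    ((hU.continuous (F t₀)).tendsto _).comp (hτ t₀ ht₀)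
  have h2 : Tendsto (fun t => U (τ t) (F t - F t₀)) (𝓝[s] t₀) (𝓝 0) := by
    refine squeeze_zero_norm (fun t => hU.norm_le _ _) ?_
    have := tendsto_iff_norm_sub_tendsto_zero.1 (hF t₀ ht₀)
    exact this
  have h3 := h1.add h2
  simpa [ContinuousWithinAt] using h3

variable (U : ∀ n, ℝ → H n →L[ℂ] H n) (B : ∀ n, H (n + 1) →L[ℂ] H n) (x : ∀ n, H n)

/-- The term with `m` collisions in the Duhamel expansion. -/
def duhamelTerm : ℕ → (n : ℕ) → ℝ → H n
  | 0, n, t => U n t (x n)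
  | m + 1, n, t => -(Complex.I • ∫ s in (0 : ℝ)..t, U n (t - s) (B n (duhamelTerm m (n + 1) s)))

/-- The Duhamel expansion. -/
def duhamelPath (n : ℕ) (t : ℝ) : H n := ∑' m, duhamelTerm U B x m n t

variable {U B x}

/-- The group law frees the integrand from `t`, so that continuity of a Duhamel term in `t` reduces
to that of a primitive. -/
lemma integral_contractionGroup [∀ n, CompleteSpace (H n)] {n : ℕ}
    (hU : IsContractionGroup (U n)) (F : ℝ → H n) (hF : Continuous F) (t : ℝ) :
    ∫ s in (0 : ℝ)..t, U n (t - s) (F s) = U n t (∫ s in (0 : ℝ)..t, U n (-s) (F s)) := by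
  rw [← ContinuousLinearMap.intervalIntegral_comp_comm]
  · exact intervalIntegral.integral_congr fun s _ => hU.map_sub t s (F s)
  · exact (continuousOn_univ.1 (hU.continuousOn_apply (continuous_neg.continuousOn)
      hF.continuousOn)).intervalIntegrable _ _

lemma continuous_duhamelTerm [∀ n, CompleteSpace (H n)] (hU : ∀ n, IsContractionGroup (U n))
    (m : ℕ) : ∀ n, Continuous (duhamelTerm U B x m n) := by
  induction m with
  | zero => exact fun n => (hU n).continuous (x n)
  | succ m ih =>
    intro n
    have hF : Continuous fun s => B n (duhamelTerm U B x m (n + 1) s) :=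
      (B n).continuous.comp (ih (n + 1))
    have hG : Continuous fun s => U n (-s) (B n (duhamelTerm U B x m (n + 1) s)) :=
      continuousOn_univ.1 ((hU n).continuousOn_apply continuous_neg.continuousOn hF.continuousOn)
    have hI : Continuous fun t => ∫ s in (0 : ℝ)..t, U n (-s) (B n (duhamelTerm U B x m (n + 1) s)) :=
      intervalIntegral.continuous_primitive (fun a b => hG.intervalIntegrable a b) 0
    have : Continuous fun t =>
        U n t (∫ s in (0 : ℝ)..t, U n (-s) (B n (duhamelTerm U B x m (n + 1) s))) :=
      continuousOn_univ.1 ((hU n).continuousOn_apply continuous_id.continuousOn hI.continuousOn)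
    refine ((this.const_smul Complex.I).neg).congr fun t => ?_
    rw [duhamelTerm, integral_contractionGroup (hU n) _ hF]
    rfl

/-- The collisions cost `C^m (n + 1) ⋯ (n + m)` and the ordered times contribute `t^m / m!`; the
factorials combine to the binomial coefficient. -/
lemma norm_duhamelTerm_le [∀ n, CompleteSpace (H n)] (hU : ∀ n, IsContractionGroup (U n))
    {C : ℝ} (hC : 0 ≤ C) (hB : ∀ n, ‖B n‖ ≤ C * (n + 1)) (m : ℕ) :
    ∀ n t, 0 ≤ t →
      ‖duhamelTerm U B x m n t‖ ≤ C ^ m * (n + m).choose m * ‖x (n + m)‖ * t ^ m := by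
  induction m with
  | zero => intro n t _; simpa [duhamelTerm] using (hU n).norm_le t (x n)
  | succ m ih =>
    intro n t ht
    have hN : ‖x (n + 1 + m)‖ = ‖x (n + (m + 1))‖ := by
      have : n + 1 + m = n + (m + 1) := by ring
      rw [this]
    set K : ℝ := C * (n + 1) * (C ^ m * (n + 1 + m).choose m * ‖x (n + 1 + m)‖) with hK
    have hbound : ∀ s ∈ Set.uIoc 0 t,
        ‖U n (t - s) (B n (duhamelTerm U B x m (n + 1) s))‖ ≤ K * s ^ m := by
      intro s hs
      rw [Set.uIoc_of_le ht] at hs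
      refine ((hU n).norm_le _ _).trans (((B n).le_opNorm _).trans ?_)
      rw [hK, mul_assoc (C * (n + 1))]
      exact mul_le_mul (hB n) (ih (n + 1) s hs.1.le) (norm_nonneg _) (by positivity)
    have h1 : ‖duhamelTerm U B x (m + 1) n t‖ ≤ ∫ s in (0 : ℝ)..t, K * s ^ m := by
      rw [duhamelTerm, norm_neg, norm_smul, Complex.norm_I, one_mul]
      refine intervalIntegral.norm_integral_le_of_norm_le ht (Eventually.of_forall fun s hs => ?_)
        (Continuous.intervalIntegrable (by fun_prop) _ _)
      exact hbound s (by rwa [Set.uIoc_of_le ht])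
    refine h1.trans (le_of_eq ?_)
    rw [intervalIntegral.integral_const_mul, integral_pow, hK, hN]
    -- Integrating `s^m` divides by `m + 1` and the outermost collision multiplies by `n + 1`; this
    -- is exactly the recursion of the binomial coefficients.
    have hch : ((n + (m + 1)).choose (m + 1) : ℝ) * (m + 1) = (n + 1 + m).choose m * (n + 1) := by
      have := Nat.choose_succ_right_eq (n + 1 + m) m
      have e : n + 1 + m - m = n + 1 := by omega
      have e' : n + (m + 1) = n + 1 + m := by ring
      rw [e] at this
      rw [e']
      exact_mod_cast this
    have hm : (m + 1 : ℝ) ≠ 0 := by positivity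
    field_simp
    rw [mul_comm ((n + (m + 1)).choose (m + 1) : ℝ) _, mul_comm] at hch
    simp only [zero_pow (Nat.succ_ne_zero m), sub_zero]
    linear_combination (-(C ^ (m + 1) * ‖x (n + (m + 1))‖ * t ^ (m + 1))) * hch

/-- The hypotheses under which the Duhamel expansion converges on `[0, T]`. -/
structure IsSummableHierarchy (U : ∀ n, ℝ → H n →L[ℂ] H n) (B : ∀ n, H (n + 1) →L[ℂ] H n)
    (x : ∀ n, H n) (C ρ T : ℝ) : Prop where
  group : ∀ n, IsContractionGroup (U n)
  nonneg : 0 ≤ C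
  norm_le : ∀ n, ‖B n‖ ≤ C * (n + 1)
  pos : 0 < ρ
  time_nonneg : 0 ≤ T
  time_le : 2 * C * T ≤ ρ
  summable : Summable fun n => ρ ^ (n + 1) * ‖x n‖

namespace IsSummableHierarchy

variable {C ρ T : ℝ}

/-- Since the binomial coefficient is at most `2 ^ (n + m)`, the collisions contribute `(2 C T)^m ≤
ρ^m`, which the weighted norm of the data absorbs. The leftover `2 ^ n / ρ ^ (n + 1)` is the price
for the output. -/
lemma term_le [∀ n, CompleteSpace (H n)] (h : IsSummableHierarchy U B x C ρ T) (m n : ℕ) {t : ℝ}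
    (ht : t ∈ Icc 0 T) : ‖duhamelTerm U B x m n t‖ ≤
      2 ^ n / ρ ^ (n + 1) * (ρ ^ (n + m + 1) * ‖x (n + m)‖) := by
  have hC := h.nonneg
  have hρ := h.pos
  have hT := h.time_nonneg
  have hch : ((n + m).choose m : ℝ) ≤ 2 ^ (n + m) := by exact_mod_cast Nat.choose_le_two_pow _ _
  calc ‖duhamelTerm U B x m n t‖
      ≤ C ^ m * (n + m).choose m * ‖x (n + m)‖ * t ^ m :=
        norm_duhamelTerm_le h.group h.nonneg h.norm_le m n t ht.1
    _ ≤ C ^ m * 2 ^ (n + m) * ‖x (n + m)‖ * T ^ m := by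
        have := ht.2
        have := ht.1
        gcongr
    _ = 2 ^ n * ((2 * C * T) ^ m * ‖x (n + m)‖) := by rw [pow_add, mul_pow, mul_pow]; ring
    _ ≤ 2 ^ n * (ρ ^ m * ‖x (n + m)‖) := by
        have := h.time_le
        gcongr
    _ = _ := by
        field_simp
        ring

lemma summable_shift (h : IsSummableHierarchy U B x C ρ T) (n : ℕ) :
    Summable fun m => ρ ^ (n + m + 1) * ‖x (n + m)‖ := by
  have := (summable_nat_add_iff n).2 h.summable
  refine this.congr fun m => ?_
  rw [add_comm m n]

lemma summable_bound (h : IsSummableHierarchy U B x C ρ T) (n : ℕ) :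
    Summable fun m => 2 ^ n / ρ ^ (n + 1) * (ρ ^ (n + m + 1) * ‖x (n + m)‖) :=
  (h.summable_shift n).mul_left _

variable [∀ n, CompleteSpace (H n)]

lemma hasSum_path (h : IsSummableHierarchy U B x C ρ T) (n : ℕ) {t : ℝ} (ht : t ∈ Icc 0 T) :
    HasSum (fun m => duhamelTerm U B x m n t) (duhamelPath U B x n t) :=
  (Summable.of_norm_bounded (h.summable_bound n) fun m => h.term_le m n ht).hasSum

lemma norm_path_le (h : IsSummableHierarchy U B x C ρ T) (n : ℕ) {t : ℝ} (ht : t ∈ Icc 0 T) :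
    ‖duhamelPath U B x n t‖ ≤ 2 ^ n / ρ ^ (n + 1) * ∑' k, ρ ^ (k + 1) * ‖x k‖ := by
  refine (tsum_of_norm_bounded (h.summable_bound n).hasSum fun m => h.term_le m n ht).trans ?_
  have hρ := h.pos
  rw [tsum_mul_left]
  refine mul_le_mul_of_nonneg_left ?_ (by positivity)
  rw [← h.summable.sum_add_tsum_nat_add n]
  have h1 : ∑' m, ρ ^ (n + m + 1) * ‖x (n + m)‖ = ∑' m, ρ ^ (m + n + 1) * ‖x (m + n)‖ :=
    tsum_congr fun m => by rw [add_comm m n]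
  rw [h1]
  exact le_add_of_nonneg_left (Finset.sum_nonneg fun _ _ => by positivity)

lemma continuousOn_path (h : IsSummableHierarchy U B x C ρ T) (n : ℕ) :
    ContinuousOn (duhamelPath U B x n) (Icc 0 T) :=
  continuousOn_tsum (fun m => (continuous_duhamelTerm h.group m n).continuousOn)
    (h.summable_bound n) fun m _ ht => h.term_le m n ht

lemma duhamel_eq (h : IsSummableHierarchy U B x C ρ T) (n : ℕ) {t : ℝ} (ht : t ∈ Icc 0 T) :
    duhamelPath U B x n t = U n t (x n) -
      Complex.I • ∫ s in (0 : ℝ)..t, U n (t - s) (B n (duhamelPath U B x (n + 1) s)) := by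
  have hsum := h.hasSum_path n ht
  have hint : HasSum (fun m => ∫ s in (0 : ℝ)..t, U n (t - s) (B n (duhamelTerm U B x m (n + 1) s)))
      (∫ s in (0 : ℝ)..t, U n (t - s) (B n (duhamelPath U B x (n + 1) s))) := by
    refine intervalIntegral.hasSum_integral_of_dominated_convergence
      (bound := fun m _ => ‖B n‖ * (2 ^ (n + 1) / ρ ^ (n + 1 + 1) *
        (ρ ^ (n + 1 + m + 1) * ‖x (n + 1 + m)‖))) (fun m => ?_) (fun m => ?_) ?_ ?_ ?_
    · have : Continuous fun s => U n (t - s) (B n (duhamelTerm U B x m (n + 1) s)) :=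
        continuousOn_univ.1 ((h.group n).continuousOn_apply (by fun_prop)
          ((B n).continuous.comp (continuous_duhamelTerm h.group m (n + 1))).continuousOn)
      exact this.aestronglyMeasurable
    · refine Eventually.of_forall fun s hs => ?_
      rw [Set.uIoc_of_le ht.1] at hs
      refine ((h.group n).norm_le _ _).trans (((B n).le_opNorm _).trans ?_)
      gcongr
      exact h.term_le m (n + 1) ⟨hs.1.le, hs.2.trans ht.2⟩
    · exact Eventually.of_forall fun s _ => (h.summable_bound (n + 1)).mul_left _
    · exact intervalIntegrable_const
    · refine Eventually.of_forall fun s hs => ?_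
      rw [Set.uIoc_of_le ht.1] at hs
      exact (((h.hasSum_path (n + 1) ⟨hs.1.le, hs.2.trans ht.2⟩).mapL (B n)).mapL (U n (t - s)))
  have h1 : HasSum (fun m => duhamelTerm U B x (m + 1) n t)
      (-(Complex.I • ∫ s in (0 : ℝ)..t, U n (t - s) (B n (duhamelPath U B x (n + 1) s)))) :=
    (hint.const_smul Complex.I).neg
  -- Removing the collision-free term `m = 0` leaves the series that was just integrated termwise.
  rw [← hasSum_nat_add_iff' 1] at hsum
  have := h1.unique hsum
  simp only [Finset.range_one, Finset.sum_singleton] at this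
  rw [sub_eq_add_neg, this]
  simp [duhamelTerm]

end IsSummableHierarchy

end Hierarchy

/-! ### Walsh functions -/

/-- The index set of the random signs `ω* ↦ h_ζ (ω_k)`. -/
abbrev Site : Type := {k : ℕ // 2 ≤ k} × Freq

section Walsh

variable {Ω : Type*} [MeasurableSpace Ω] {μ : Measure Ω} [IsProbabilityMeasure μ]
  {h : Freq → Ω → ℝ}

/-- The sign `h_ζ (ω_k)`. -/
def sign (h : Freq → Ω → ℝ) (p : Site) (ω : OmegaStar Ω) : ℝ := h p.2 (ω p.1)

/-- The product of the signs of a finite set of sites. -/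
def walsh (h : Freq → Ω → ℝ) (s : Finset Site) (ω : OmegaStar Ω) : ℂ :=
  ((∏ p ∈ s, sign h p ω : ℝ) : ℂ)

omit [MeasurableSpace Ω] in
-- Signs at common sites square to `1` and drop out. The hypothesis is imposed pointwise because the
-- `h_ζ` are signs only almost surely.
lemma walsh_mul_of_sq {ω : OmegaStar Ω} (hω : ∀ p, sign h p ω * sign h p ω = 1)
    (s t : Finset Site) : walsh h s ω * walsh h t ω = walsh h (symmDiff s t) ω := by
  have hsd : ∀ s t : Finset Site,
      ∏ p ∈ s, sign h p ω = (∏ p ∈ s \ t, sign h p ω) * ∏ p ∈ s ∩ t, sign h p ω := fun s t => by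
    rw [mul_comm, Finset.prod_inter_mul_prod_sdiff]
  have hi : (∏ p ∈ s ∩ t, sign h p ω) * ∏ p ∈ s ∩ t, sign h p ω = 1 := by
    rw [← Finset.prod_mul_distrib]
    exact Finset.prod_eq_one fun p _ => hω p
  unfold walsh
  rw [← Complex.ofReal_mul, symmDiff, Finset.sup_eq_union,
    Finset.prod_union (by exact disjoint_sdiff_sdiff), hsd s t, hsd t s, Finset.inter_comm t s]
  congr 1
  linear_combination ((∏ p ∈ s \ t, sign h p ω) * ∏ p ∈ t \ s, sign h p ω) * hi

namespace IsBernoulliFamily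

variable (hB : IsBernoulliFamily μ h)
include hB

omit [IsProbabilityMeasure μ] in
lemma measurable_sign (p : Site) : Measurable (sign h p) :=
  (hB.measurable p.2).comp (measurable_pi_apply p.1)

lemma ae_eq_one_or (ζ : Freq) : ∀ᵐ w ∂μ, h ζ w = 1 ∨ h ζ w = -1 := by
  have hm1 : MeasurableSet {w | h ζ w = 1} := hB.measurable ζ (measurableSet_singleton 1)
  have hm2 : MeasurableSet {w | h ζ w = -1} := hB.measurable ζ (measurableSet_singleton (-1))
  have hd : Disjoint {w | h ζ w = 1} {w | h ζ w = -1} := by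
    rw [Set.disjoint_left]
    intro w h1 h2
    simp only [Set.mem_ofPred_eq] at h1 h2
    norm_num [h1] at h2
  have hu : μ ({w | h ζ w = 1} ∪ {w | h ζ w = -1}) = 1 := by
    rw [measure_union hd hm2, hB.prob_one, hB.prob_neg_one, ENNReal.add_halves]
  exact (prob_compl_eq_zero_iff (hm1.union hm2)).2 hu

lemma integral_eq_zero (ζ : Freq) : ∫ w, h ζ w ∂μ = 0 := by
  have hm1 : MeasurableSet {w | h ζ w = 1} := hB.measurable ζ (measurableSet_singleton 1)
  have hm2 : MeasurableSet {w | h ζ w = -1} := hB.measurable ζ (measurableSet_singleton (-1))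
  have he : h ζ =ᵐ[μ] fun w => {w | h ζ w = 1}.indicator (fun _ => (1 : ℝ)) w -
      {w | h ζ w = -1}.indicator (fun _ => (1 : ℝ)) w := by
    filter_upwards [hB.ae_eq_one_or ζ] with w hw
    rcases hw with hw | hw <;> norm_num [Set.indicator, hw]
  rw [integral_congr_ae he, integral_sub ((integrable_const _).indicator hm1)
    ((integrable_const _).indicator hm2), integral_indicator_const _ hm1,
    integral_indicator_const _ hm2]
  simp [measureReal_def, hB.prob_one, hB.prob_neg_one]

lemma ae_sign_sq : ∀ᵐ ω ∂(pStar μ), ∀ p, sign h p ω * sign h p ω = 1 := by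
  rw [ae_all_iff]
  intro p
  have hmp := measurePreserving_eval_infinitePi (fun _ : {k : ℕ // 2 ≤ k} => μ) p.1
  filter_upwards [hmp.quasiMeasurePreserving.ae (hB.ae_eq_one_or p.2)] with ω hω
  rcases hω with hω | hω <;> simp [sign, hω]

lemma integral_sign (p : Site) : ∫ ω, sign h p ω ∂(pStar μ) = 0 := by
  have hmp := measurePreserving_eval_infinitePi (fun _ : {k : ℕ // 2 ≤ k} => μ) p.1
  have h0 : ∫ w, h p.2 w ∂(Measure.map (Function.eval p.1) (pStar μ)) = 0 := by
    rw [hmp.map_eq]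
    exact hB.integral_eq_zero p.2
  rwa [integral_map hmp.measurable.aemeasurable
    (hB.measurable p.2).aestronglyMeasurable] at h0

/-- Independence has two layers: between levels it comes from the product measure, within a level
from the Bernoulli family. -/
lemma iIndepFun_sign : iIndepFun (sign h) (pStar μ) := by
  refine iIndepFun_uncurry' (X := fun (k : {k : ℕ // 2 ≤ k}) ζ (ω : OmegaStar Ω) => h ζ (ω k))
    (fun k ζ => (hB.measurable ζ).comp (measurable_pi_apply k)) ?_ fun k => ?_
  · exact iIndepFun_infinitePi (P := fun _ : {k : ℕ // 2 ≤ k} => μ) (X := fun _ w ζ => h ζ w)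
      fun _ => measurable_pi_lambda _ hB.measurable
  · have hmp := measurePreserving_eval_infinitePi (fun _ : {k : ℕ // 2 ≤ k} => μ) k
    have hind := hB.indep
    rw [← hmp.map_eq] at hind
    have hm : ∀ ζ, Measurable fun ω : OmegaStar Ω => h ζ (ω k) := fun ζ =>
      (hB.measurable ζ).comp (measurable_pi_apply k)
    have hpm : IsProbabilityMeasure (Measure.map (Function.eval k)
        (Measure.infinitePi fun _ : {k : ℕ // 2 ≤ k} => μ)) := by
      rw [hmp.map_eq]
      infer_instance
    rw [iIndepFun_iff_map_fun_eq_infinitePi_map hm]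
    rw [iIndepFun_iff_map_fun_eq_infinitePi_map hB.measurable,
      Measure.map_map (measurable_pi_lambda _ hB.measurable) hmp.measurable] at hind
    refine hind.trans ?_
    congr 1
    ext1 ζ
    rw [Measure.map_map (hB.measurable ζ) hmp.measurable]
    rfl

lemma integral_walsh {s : Finset Site} (hs : s.Nonempty) : ∫ ω, walsh h s ω ∂(pStar μ) = 0 := by
  obtain ⟨p, hp⟩ := hs
  have h1 := iIndepFun.integral_fun_prod_eq_prod_integral (𝕜 := ℝ)
    (hB.iIndepFun_sign.precomp (g := ((↑) : s → Site)) Subtype.val_injective)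
    fun i => (hB.measurable_sign i).aestronglyMeasurable
  have h2 : ∫ ω, ∏ p ∈ s, sign h p ω ∂(pStar μ) = 0 := by
    simp_rw [← Finset.prod_coe_sort s]
    refine h1.trans (Finset.prod_eq_zero (Finset.mem_univ ⟨p, hp⟩) ?_)
    exact hB.integral_sign p
  unfold walsh
  rw [integral_complex_ofReal, h2, Complex.ofReal_zero]

lemma ae_norm_walsh : ∀ᵐ ω ∂(pStar μ), ∀ s, ‖walsh h s ω‖ = 1 := by
  filter_upwards [hB.ae_sign_sq] with ω hω s
  have h1 := walsh_mul_of_sq hω s s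
  have h2 : ‖walsh h s ω‖ * ‖walsh h s ω‖ = 1 := by
    rw [← norm_mul, h1]; simp [walsh]
  nlinarith [norm_nonneg (walsh h s ω)]

lemma memLp_walsh (s : Finset Site) (p : ℝ≥0∞) : MemLp (walsh h s) p (pStar μ) := by
  refine MemLp.of_bound ?_ 1 ?_
  · refine (Measurable.complex_ofReal ?_).aestronglyMeasurable
    exact Finset.measurable_prod _ fun q _ => hB.measurable_sign q
  · filter_upwards [hB.ae_norm_walsh] with ω hω using (hω s).le

end IsBernoulliFamily

/-- The Walsh functions as elements of `L^p(Ω*)`. -/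
def walshLp (hB : IsBernoulliFamily μ h) (p : ℝ≥0∞) (s : Finset Site) : Lp ℂ p (pStar μ) :=
  (hB.memLp_walsh s p).toLp

lemma coeFn_walshLp (hB : IsBernoulliFamily μ h) (p : ℝ≥0∞) (s : Finset Site) :
    walshLp hB p s =ᵐ[pStar μ] walsh h s :=
  MemLp.coeFn_toLp _

/-- The product is the Walsh function of the symmetric difference, which is nonempty, hence of mean
zero, unless `s = t`. -/
lemma integral_conj_walsh_mul (hB : IsBernoulliFamily μ h) (s t : Finset Site) :
    ∫ ω, walsh h t ω * starRingEnd ℂ (walsh h s ω) ∂(pStar μ) = if s = t then 1 else 0 := by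
  have h1 : (fun ω => walsh h t ω * starRingEnd ℂ (walsh h s ω)) =ᵐ[pStar μ]
      walsh h (symmDiff t s) := by
    filter_upwards [hB.ae_sign_sq] with ω hω
    rw [← walsh_mul_of_sq hω]
    simp [walsh, Complex.conj_ofReal]
  rw [integral_congr_ae h1]
  split_ifs with hst
  · simp [hst, walsh]
  · refine hB.integral_walsh (Finset.nonempty_iff_ne_empty.2 fun h0 => hst ?_)
    exact (symmDiff_eq_bot.1 h0).symm

/-- Multiplication by a Walsh function on `L²(Ω*)`. -/
def walshMul (hB : IsBernoulliFamily μ h) (s : Finset Site) :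
    Lp ℂ 2 (pStar μ) →L[ℂ] Lp ℂ 2 (pStar μ) :=
  (ContinuousLinearMap.mul ℂ ℂ).holderL (pStar μ) ∞ 2 2 (walshLp hB ∞ s)

lemma coeFn_walshMul (hB : IsBernoulliFamily μ h) (s : Finset Site) (g : Lp ℂ 2 (pStar μ)) :
    walshMul hB s g =ᵐ[pStar μ] fun ω => walsh h s ω * g ω := by
  have h1 := (ContinuousLinearMap.mul ℂ ℂ).coeFn_holder (r := 2) (walshLp hB ∞ s) g
  filter_upwards [h1, coeFn_walshLp hB ∞ s] with ω e1 e2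
  exact e1.trans (by simp [e2])

lemma walshMul_walshLp (hB : IsBernoulliFamily μ h) (s t : Finset Site) :
    walshMul hB s (walshLp hB 2 t) = walshLp hB 2 (symmDiff t s) := by
  refine Lp.ext ?_
  filter_upwards [coeFn_walshMul hB s (walshLp hB 2 t), coeFn_walshLp hB 2 t,
    coeFn_walshLp hB 2 (symmDiff t s), hB.ae_sign_sq] with ω e1 e2 e3 e4
  rw [e1, e2, e3, ← walsh_mul_of_sq e4, mul_comm]

end Walsh

/-! ### Summation over frequencies -/

lemma freqSq_nonneg (ζ : Freq) : 0 ≤ freqSq ζ := Finset.sum_nonneg fun _ _ => sq_nonneg _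

lemma bracket_sq (ζ : Freq) : bracket ζ ^ 2 = 1 + freqSq ζ :=
  Real.sq_sqrt (by linarith [freqSq_nonneg ζ])

lemma one_le_bracket (ζ : Freq) : 1 ≤ bracket ζ :=
  Real.one_le_sqrt.2 (by linarith [freqSq_nonneg ζ])

lemma bracket_pos (ζ : Freq) : 0 < bracket ζ := zero_lt_one.trans_le (one_le_bracket ζ)

/-- Write `ζ = (ζ - a + b) + a - b`, use convexity of the square, and bound the sum of the squared
brackets by their product, each being at least `1`. -/
lemma bracket_sq_le (ζ a b : Freq) :
    bracket ζ ^ 2 ≤ 3 * (bracket (ζ - a + b) * bracket a * bracket b) ^ 2 := by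
  have h1 : freqSq ζ ≤ 3 * (freqSq (ζ - a + b) + freqSq a + freqSq b) := by
    unfold freqSq
    rw [← Finset.sum_add_distrib, ← Finset.sum_add_distrib, Finset.mul_sum]
    refine Finset.sum_le_sum fun i _ => ?_
    simp only [Pi.add_apply, Pi.sub_apply]
    push_cast
    set x := (ζ i : ℝ)
    set y := (a i : ℝ)
    set z := (b i : ℝ)
    -- With `u = x - y + z`, so that `x = u + y - z`, the difference of the two sides is `(u - y)² +
    -- (u + z)² + (y + z)²`.
    nlinarith [sq_nonneg (x - y + z - y), sq_nonneg (x - y + z + z), sq_nonneg (y + z)]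
  rw [mul_pow, mul_pow, bracket_sq, bracket_sq, bracket_sq, bracket_sq]
  have h2 := freqSq_nonneg (ζ - a + b)
  have h3 := freqSq_nonneg a
  have h4 := freqSq_nonneg b
  have h5 : 0 ≤ freqSq (ζ - a + b) * freqSq a := by positivity
  have h6 : 0 ≤ freqSq (ζ - a + b) * freqSq b := by positivity
  have h7 : 0 ≤ freqSq a * freqSq b := by positivity
  have h8 : 0 ≤ freqSq (ζ - a + b) * freqSq a * freqSq b := by positivity
  nlinarith

lemma norm_le_bracket (ζ : Freq) : ‖fun i => (ζ i : ℝ)‖ ≤ bracket ζ := by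
  refine (pi_norm_le_iff_of_nonneg (bracket_pos ζ).le).2 fun i => ?_
  refine Real.le_sqrt_of_sq_le ?_
  rw [Real.norm_eq_abs, sq_abs]
  have := Finset.single_le_sum (f := fun i => (ζ i : ℝ) ^ 2) (fun _ _ => sq_nonneg _)
    (Finset.mem_univ i)
  simp only [freqSq]
  linarith

lemma summable_bracket {s : ℝ} (hs : 3 < s) : Summable fun a : Freq => bracket a ^ (-s) := by
  let L : Submodule ℤ (Fin 3 → ℝ) := Submodule.span ℤ (Set.range (Pi.basisFun ℝ (Fin 3)))
  have hrank : Module.finrank ℤ L = 3 := by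
    rw [ZLattice.rank ℝ L]
    simp
  have hmem : ∀ a : Freq, (fun i => (a i : ℝ)) ∈ L := by
    intro a
    have : (fun i => (a i : ℝ)) = ∑ i, a i • Pi.basisFun ℝ (Fin 3) i := by
      ext j
      simp [Pi.single_apply]
    rw [this]
    exact Submodule.sum_mem _ fun i _ => Submodule.smul_mem _ _
      (Submodule.subset_span (Set.mem_range_self i))
  have h1 := ZLattice.summable_norm_rpow L (-s) (by rw [hrank]; push_cast; linarith)
  have hinj : Function.Injective fun a : Freq => (⟨fun i => (a i : ℝ), hmem a⟩ : L) := by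
    intro a b hab
    ext i
    have : (a i : ℝ) = b i := congrFun (congrArg Subtype.val hab) i
    exact_mod_cast this
  have h2 := h1.comp_injective hinj
  refine Summable.of_norm_bounded_eventually h2 ?_
  -- At the frequency `0` the lattice norm vanishes and its power is `0` by convention, so the
  -- comparison fails there; one term does not matter.
  have hfin : {(0 : Freq)}ᶜ ∈ (cofinite : Filter Freq) := (Set.finite_singleton 0).compl_mem_cofinite
  filter_upwards [hfin] with a ha
  have ha' : a ≠ 0 := ha
  have hpos : 0 < ‖fun i => (a i : ℝ)‖ := by
    refine norm_pos_iff.2 fun h0 => ha' ?_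
    ext i
    have : (a i : ℝ) = 0 := congrFun h0 i
    exact_mod_cast this
  rw [Real.norm_of_nonneg (Real.rpow_nonneg (bracket_pos a).le _)]
  exact Real.rpow_le_rpow_of_nonpos hpos (norm_le_bracket a) (by linarith)

/-! ### The interaction of four frequencies -/

/-- The quotient of the Sobolev weights before and after a collision. -/
def ratio (α : ℝ) (ζ : Freq) (ab : Freq × Freq) : ℝ :=
  (bracket ζ / (bracket (ζ - ab.1 + ab.2) * bracket ab.1 * bracket ab.2)) ^ α

/-- The frequencies that occur an odd number of times among `ζ`, `ζ - a + b`, `a` and `b`. -/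
def oddFreqs (ζ : Freq) (ab : Freq × Freq) : Finset Freq :=
  symmDiff (symmDiff {ζ} {ζ - ab.1 + ab.2}) (symmDiff {ab.1} {ab.2})

lemma ratio_sq_le {α : ℝ} (hα : 0 ≤ α) (ζ : Freq) (ab : Freq × Freq) : ratio α ζ ab ^ 2 ≤ 3 ^ α := by
  have h1 := bracket_pos ζ
  have h2 := bracket_pos (ζ - ab.1 + ab.2)
  have h3 := bracket_pos ab.1
  have h4 := bracket_pos ab.2
  have h5 := bracket_sq_le ζ ab.1 ab.2
  rw [ratio, Real.rpow_pow_comm (by positivity)]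
  refine Real.rpow_le_rpow (by positivity) ?_ hα
  rw [div_pow, div_le_iff₀ (by positivity)]
  exact h5

lemma ratio_sq_of_eq {α : ℝ} {ζ : Freq} {ab : Freq × Freq} {d : Freq}
    (h : bracket ζ / (bracket (ζ - ab.1 + ab.2) * bracket ab.1 * bracket ab.2) =
      bracket d ^ (-2 : ℝ)) : ratio α ζ ab ^ 2 = bracket d ^ (-(4 * α)) := by
  rw [ratio, h, ← Real.rpow_mul (bracket_pos d).le, ← Real.rpow_natCast,
    ← Real.rpow_mul (bracket_pos d).le]
  congr 1
  push_cast
  ring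

/-- For `a = b` the bracket of `ζ` cancels and only the decay in `a` is left. This resonance is what
requires `4α > 3`. -/
lemma ratio_sq_diag (α : ℝ) (ζ a : Freq) : ratio α ζ (a, a) ^ 2 = bracket a ^ (-(4 * α)) := by
  refine ratio_sq_of_eq ?_
  have h1 := bracket_pos ζ
  have h2 := bracket_pos a
  rw [Real.rpow_neg h2.le, Real.rpow_two]
  simp only [sub_add_cancel]
  field_simp

lemma ratio_sq_left (α : ℝ) (ζ b : Freq) : ratio α ζ (ζ, b) ^ 2 = bracket b ^ (-(4 * α)) := by
  refine ratio_sq_of_eq ?_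
  have h1 := bracket_pos ζ
  have h2 := bracket_pos b
  rw [Real.rpow_neg h2.le, Real.rpow_two]
  simp only [sub_self, zero_add]
  field_simp

lemma oddFreqs_diag (ζ a : Freq) : oddFreqs ζ (a, a) = ∅ := by
  simp [oddFreqs]

lemma oddFreqs_left (ζ b : Freq) : oddFreqs ζ (ζ, b) = ∅ := by
  simp [oddFreqs]

/-- Otherwise `b` differs from `a` and from `ζ - a + b`, so only `ζ` can cancel it; then `a = ζ - a
+ b` with `b = ζ`, so `a = b` as `ℤ³` has no 2-torsion. -/
lemma eq_of_oddFreqs_eq_empty {ζ : Freq} {ab : Freq × Freq} (h : oddFreqs ζ ab = ∅) :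
    ab.1 = ab.2 ∨ ab.1 = ζ := by
  obtain ⟨a, b⟩ := ab
  simp only [oddFreqs] at h ⊢
  by_contra! hne
  obtain ⟨hab, haz⟩ := hne
  have hcb : ζ - a + b ≠ b := fun h0 => haz (by simpa [sub_eq_zero, eq_comm] using h0)
  have hm : ∀ f : Freq, f ∉ symmDiff (symmDiff ({ζ} : Finset Freq) {ζ - a + b})
      (symmDiff {a} {b}) := by simp [h]
  simp only [Finset.mem_symmDiff, Finset.mem_singleton] at hm
  by_cases hbz : b = ζ
  · subst hbz
    have hac : a ≠ b - a + b := by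
      intro h0
      refine hab ?_
      ext i
      have := congrFun h0 i
      simp only [Pi.add_apply, Pi.sub_apply] at this
      omega
    have := hm a
    tauto
  · have := hm b
    have h1 : b ≠ a := hab.symm
    have h2 : b ≠ ζ - a + b := hcb.symm
    tauto

/-- Adding `ζ` to the odd set leaves the odd part of `{ζ - a + b, a, b}`. Without resonance `b`
survives in it, and `a` survives unless `a = ζ - a + b`, when `2 a = ζ + b` and the integer division
is exact. -/
lemma mem_of_oddFreqs_ne_empty {ζ : Freq} {ab : Freq × Freq} (h : oddFreqs ζ ab ≠ ∅) :
    ab.2 ∈ symmDiff {ζ} (oddFreqs ζ ab) ∧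
      (ab.1 ∈ symmDiff {ζ} (oddFreqs ζ ab) ∨ ab.1 = fun i => (ζ i + ab.2 i) / 2) := by
  obtain ⟨a, b⟩ := ab
  have hab : a ≠ b := by rintro rfl; exact h (oddFreqs_diag ζ a)
  have haz : a ≠ ζ := by rintro rfl; exact h (oddFreqs_left a b)
  have hcb : ζ - a + b ≠ b := fun h0 => haz (by simpa [sub_eq_zero, eq_comm] using h0)
  have hS : symmDiff {ζ} (oddFreqs ζ (a, b)) = symmDiff {ζ - a + b} (symmDiff {a} {b}) := by
    simp only [oddFreqs]
    rw [symmDiff_assoc, symmDiff_symmDiff_cancel_left]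
  rw [hS]
  simp only [Finset.mem_symmDiff, Finset.mem_singleton]
  refine ⟨?_, ?_⟩
  · have h1 : b ≠ a := hab.symm
    have h2 : b ≠ ζ - a + b := hcb.symm
    tauto
  · by_cases hac : a = ζ - a + b
    · right
      ext i
      have := congrFun hac i
      simp only [Pi.add_apply, Pi.sub_apply] at this ⊢
      omega
    · left; tauto

lemma card_symmDiff_oddFreqs_le (ζ : Freq) (ab : Freq × Freq) :
    (symmDiff {ζ} (oddFreqs ζ ab)).card ≤ 3 := by
  have hS : symmDiff {ζ} (oddFreqs ζ ab) =
      symmDiff {ζ - ab.1 + ab.2} (symmDiff {ab.1} {ab.2}) := by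
    simp only [oddFreqs]
    rw [symmDiff_assoc, symmDiff_symmDiff_cancel_left]
  rw [hS]
  refine (Finset.card_le_card (t := {ζ - ab.1 + ab.2, ab.1, ab.2}) fun f hf => ?_).trans
    Finset.card_le_three
  simp only [Finset.mem_symmDiff, Finset.mem_singleton, Finset.mem_insert] at hf ⊢
  tauto

lemma tsum_ratio_resonant_le {α : ℝ} (ζ : Freq) :
    ∑' ab, {ab | oddFreqs ζ ab = ∅}.indicator (fun ab => ENNReal.ofReal (ratio α ζ ab ^ 2)) ab ≤
      2 * ∑' a, ENNReal.ofReal (bracket a ^ (-(4 * α))) := by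
  have h1 : ∀ ab : Freq × Freq,
      {ab | oddFreqs ζ ab = ∅}.indicator (fun ab => ENNReal.ofReal (ratio α ζ ab ^ 2)) ab ≤
      -- The two lines `a = b` and `a = ζ` are summed separately; counting their intersection twice
      -- is harmless.
      (if ab.2 = ab.1 then ENNReal.ofReal (bracket ab.1 ^ (-(4 * α))) else 0) +
        if ab.1 = ζ then ENNReal.ofReal (bracket ab.2 ^ (-(4 * α))) else 0 := by
    rintro ⟨a, b⟩
    by_cases h : oddFreqs ζ (a, b) = ∅
    · rw [Set.indicator_of_mem (by exact h)]
      rcases eq_of_oddFreqs_eq_empty h with h' | h' <;> simp only at h' <;> subst h'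
      · simp [ratio_sq_diag]
      · simp [ratio_sq_left]
    · rw [Set.indicator_of_notMem (by exact h)]
      exact zero_le
  refine (ENNReal.tsum_le_tsum h1).trans ?_
  rw [ENNReal.tsum_add, two_mul, ENNReal.tsum_prod', ENNReal.tsum_prod']
  simp
  rw [ENNReal.tsum_comm]
  simp

lemma tsum_ratio_nonresonant_le {α : ℝ} (hα : 0 ≤ α) (ζ : Freq) {D : Finset Freq} (hD : D ≠ ∅) :
    ∑' ab, {ab | oddFreqs ζ ab = D}.indicator (fun ab => ENNReal.ofReal (ratio α ζ ab ^ 2)) ab ≤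
      12 * ENNReal.ofReal (3 ^ α) := by
  by_cases hne : ∃ ab, oddFreqs ζ ab = D
  swap
  · push Not at hne
    simp [Set.indicator, hne]
  set S := symmDiff {ζ} D with hS
  have hcard : S.card ≤ 3 := by
    obtain ⟨ab, rfl⟩ := hne
    exact card_symmDiff_oddFreqs_le ζ ab
  -- Both `a` and `b` lie in `S`, or `b` does and `a` is the midpoint of `ζ` and `b`: at most `3 * 3
  -- + 3 = 12` pairs.
  set T : Finset (Freq × Freq) := (S ×ˢ S) ∪ S.image fun b => (fun i => (ζ i + b i) / 2, b) with hT
  have hTcard : T.card ≤ 12 := by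
    refine (Finset.card_union_le _ _).trans ?_
    have h1 := Finset.card_image_le (s := S) (f := fun b : Freq =>
      ((fun i => (ζ i + b i) / 2, b) : Freq × Freq))
    rw [Finset.card_product]
    nlinarith
  have hsub : ∀ ab, oddFreqs ζ ab = D → ab ∈ T := by
    rintro ⟨a, b⟩ rfl
    have := mem_of_oddFreqs_ne_empty hD
    rw [← hS] at this
    simp only at this
    rw [hT, Finset.mem_union, Finset.mem_product, Finset.mem_image]
    rcases this with ⟨hb, ha | ha⟩
    · exact Or.inl ⟨ha, hb⟩
    · exact Or.inr ⟨b, hb, by rw [ha]⟩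
  rw [tsum_eq_sum (s := T) fun ab hab => Set.indicator_of_notMem
    (s := {ab | oddFreqs ζ ab = D}) (fun h => hab (hsub ab h)) _]
  calc ∑ ab ∈ T, {ab | oddFreqs ζ ab = D}.indicator (fun ab => ENNReal.ofReal (ratio α ζ ab ^ 2)) ab
      ≤ ∑ ab ∈ T, ENNReal.ofReal (3 ^ α) := by
        refine Finset.sum_le_sum fun ab _ => ?_
        refine (Set.indicator_le_self' (fun _ _ => zero_le) ab).trans ?_
        exact ENNReal.ofReal_le_ofReal (ratio_sq_le hα ζ ab)
    _ = T.card * ENNReal.ofReal (3 ^ α) := by rw [Finset.sum_const, nsmul_eq_mul]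
    _ ≤ 12 * ENNReal.ofReal (3 ^ α) := by
        gcongr
        exact_mod_cast hTcard

/-- The collision estimate: the weights of the pairs `(a, b)` that produce the same product of
signs are square summable, uniformly. -/
lemma exists_tsum_ratio_le {α : ℝ} (hα : 3 / 4 < α) : ∃ C : ℝ≥0, 0 < C ∧ ∀ (ζ : Freq)
    (D : Finset Freq), ∑' ab, {ab | oddFreqs ζ ab = D}.indicator
      (fun ab => ENNReal.ofReal (ratio α ζ ab ^ 2)) ab ≤ (C : ℝ≥0∞) ^ 2 := by
  have hs := summable_bracket (s := 4 * α) (by linarith)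
  have hZ : ∑' a, ENNReal.ofReal (bracket a ^ (-(4 * α))) ≠ ∞ := by
    rw [← ENNReal.ofReal_tsum_of_nonneg (fun a => Real.rpow_nonneg (bracket_pos a).le _) hs]
    exact ENNReal.ofReal_ne_top
  have hK : 2 * ∑' a, ENNReal.ofReal (bracket a ^ (-(4 * α))) + 12 * ENNReal.ofReal (3 ^ α) ≠ ∞ := by
    finiteness
  lift (2 * ∑' a, ENNReal.ofReal (bracket a ^ (-(4 * α))) + 12 * ENNReal.ofReal (3 ^ α)) to ℝ≥0
    using hK with K hKeq
  -- `K ≤ (K + 1)²` replaces a square root and makes the constant positive.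
  refine ⟨K + 1, by positivity, fun ζ D => ?_⟩
  have hle : (K : ℝ≥0∞) ≤ ((K + 1 : ℝ≥0) : ℝ≥0∞) ^ 2 := by
    have : K ≤ (K + 1) ^ 2 := by nlinarith [zero_le (a := K)]
    exact_mod_cast this
  refine le_trans ?_ hle
  rw [hKeq]
  by_cases hD : D = ∅
  · subst hD
    exact (tsum_ratio_resonant_le ζ).trans le_self_add
  · exact (tsum_ratio_nonresonant_le (by linarith) ζ hD).trans le_add_self

/-! ### Fourier coefficients of random density matrices -/

/-- Pairs `(ξ, ξ')` of `k`-tuples of frequencies. -/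
abbrev Mode (k : ℕ) : Type := (Fin k → Freq) × (Fin k → Freq)

/-- `modeVec` as an equivalence. -/
def modeEquiv (k : ℕ) : Mode k ≃ (Coord k → ℤ) where
  toFun m := modeVec m.1 m.2
  invFun n := (fun j i => n (Sum.inl (j, i)), fun j i => -n (Sum.inr (j, i)))
  left_inv m := by ext <;> simp [modeVec]
  right_inv n := by ext (p | p) <;> simp [modeVec]

/-- The monomial of frequency `(ξ, -ξ')`. -/
def monomial {k : ℕ} (m : Mode k) : DensityMatrix k := monomialBasis k (modeEquiv k m)

/-- The Fourier transform at a given mode, as a continuous linear functional. -/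
def hatL {k : ℕ} (m : Mode k) : DensityMatrix k →L[ℂ] ℂ := innerSL ℂ (monomial m)

lemma hat_eq_repr {k : ℕ} (σ : DensityMatrix k) (m : Mode k) :
    σ.hat m.1 m.2 = (monomialBasis k).repr σ (modeEquiv k m) :=
  (UnitAddTorus.mFourierBasis_repr σ _).symm

lemma hatL_apply {k : ℕ} (m : Mode k) (σ : DensityMatrix k) : hatL m σ = σ.hat m.1 m.2 := by
  rw [hat_eq_repr, HilbertBasis.repr_apply_apply]
  rfl

lemma inner_monomial {k : ℕ} (m m' : Mode k) :
    inner ℂ (monomial m) (monomial m') = if m = m' then 1 else 0 := by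
  classical
  unfold monomial
  rw [orthonormal_iff_ite.1 (monomialBasis k).orthonormal]
  simp

lemma hatL_monomial {k : ℕ} (m m' : Mode k) :
    hatL m (monomial m') = if m = m' then 1 else 0 := inner_monomial m m'

lemma ext_hat {k : ℕ} {σ τ : DensityMatrix k}
    (h : ∀ m : Mode k, σ.hat m.1 m.2 = τ.hat m.1 m.2) : σ = τ := by
  apply (monomialBasis k).repr.injective
  ext n
  have := h ((modeEquiv k).symm n)
  rwa [hat_eq_repr, hat_eq_repr, Equiv.apply_symm_apply] at this

lemma enorm_sq_eq_tsum_hat {k : ℕ} (σ : DensityMatrix k) :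
    ‖σ‖ₑ ^ 2 = ∑' m : Mode k, ‖σ.hat m.1 m.2‖ₑ ^ 2 := by
  have h1 : ‖σ‖ₑ = ‖(monomialBasis k).repr σ‖ₑ := by
    simp [enorm_eq_nnnorm]
  rw [h1, LTwo.enorm_sq, ← (modeEquiv k).tsum_eq]
  simp_rw [hat_eq_repr]

section Random

variable {Ω : Type*} [MeasurableSpace Ω] {μ : Measure Ω} [IsProbabilityMeasure μ]
  {h : Freq → Ω → ℝ}

/-- The Fourier transform of a random density matrix at a given mode, as a random variable. -/
def coefL {k : ℕ} (m : Mode k) : RandomDM μ k →L[ℂ] Lp ℂ 2 (pStar μ) :=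
  (hatL m).compLpL 2 (pStar μ)

lemma coeFn_coefL {k : ℕ} (m : Mode k) (σ : RandomDM μ k) :
    coefL m σ =ᵐ[pStar μ] fun ω => DensityMatrix.hat (σ ω) m.1 m.2 := by
  filter_upwards [(hatL m).coeFn_compLpL (p := 2) σ] with ω hω
  exact hω.trans (hatL_apply m _)

lemma ext_coefL {k : ℕ} {σ τ : RandomDM μ k} (h : ∀ m : Mode k, coefL m σ = coefL m τ) :
    σ = τ := by
  refine Lp.ext ?_
  have h1 := ae_all_iff.2 fun m : Mode k => coeFn_coefL m σ
  have h2 := ae_all_iff.2 fun m : Mode k => coeFn_coefL m τ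
  filter_upwards [h1, h2] with ω e1 e2
  exact ext_hat fun m => by rw [← e1, ← e2, h m]

/-- The random density matrix `W_s ⊗ e_m`. -/
def tensor (hB : IsBernoulliFamily μ h) {k : ℕ} (s : Finset Site) (m : Mode k) : RandomDM μ k :=
  (ContinuousLinearMap.toSpanSingleton ℂ (monomial m)).compLp (walshLp hB 2 s)

lemma coeFn_tensor (hB : IsBernoulliFamily μ h) {k : ℕ} (s : Finset Site) (m : Mode k) :
    tensor hB s m =ᵐ[pStar μ] fun ω => walsh h s ω • monomial m := by
  filter_upwards [(ContinuousLinearMap.toSpanSingleton ℂ (monomial m)).coeFn_compLp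
    (walshLp hB 2 s), coeFn_walshLp hB 2 s] with ω e1 e2
  exact e1.trans (by rw [e2, ContinuousLinearMap.toSpanSingleton_apply])

lemma coefL_tensor (hB : IsBernoulliFamily μ h) {k : ℕ} (s : Finset Site) (m m' : Mode k) :
    coefL m (tensor hB s m') = if m = m' then walshLp hB 2 s else 0 := by
  refine Lp.ext ?_
  have e0 : ((if m = m' then walshLp hB 2 s else 0 : Lp ℂ 2 (pStar μ)) : OmegaStar Ω → ℂ)
      =ᵐ[pStar μ] fun ω => if m = m' then walsh h s ω else 0 := by
    split_ifs
    · exact coeFn_walshLp hB 2 s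
    · exact Lp.coeFn_zero _ _ _
  filter_upwards [(hatL m).coeFn_compLpL (p := 2) (tensor hB s m'), coeFn_tensor hB s m', e0]
    with ω e1 e2 e3
  rw [e3]
  refine e1.trans ?_
  rw [e2, map_smul, hatL_monomial]
  simp

lemma orthonormal_tensor (hB : IsBernoulliFamily μ h) (k : ℕ) :
    Orthonormal ℂ fun i : Finset Site × Mode k => tensor hB i.1 i.2 := by
  classical
  rw [orthonormal_iff_ite]
  rintro ⟨s, m⟩ ⟨t, m'⟩
  rw [L2.inner_def]
  have h1 : (fun ω => inner ℂ (tensor hB s m ω) (tensor hB t m' ω)) =ᵐ[pStar μ]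
      fun ω => walsh h t ω * starRingEnd ℂ (walsh h s ω) * inner ℂ (monomial m) (monomial m') := by
    filter_upwards [coeFn_tensor hB s m, coeFn_tensor hB t m'] with ω e1 e2
    rw [e1, e2, inner_smul_left, inner_smul_right]
    ring
  rw [integral_congr_ae h1, integral_mul_const, integral_conj_walsh_mul hB, inner_monomial]
  by_cases h2 : s = t <;> by_cases h3 : m = m' <;> simp [h2, h3]

/-! ### The model space -/

/-- Finite sets of sites of level greater than `k`. -/
abbrev Pattern (k : ℕ) : Type := {s : Finset Site // ∀ q ∈ s, k < q.1.1}

/-- Indices of the terms `W_s ⊗ e_m` that generate the random density matrices of order `k` which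
depend on `ω_{k+1}, ω_{k+2}, …` only. -/
abbrev Idx (k : ℕ) : Type := Pattern k × Mode k

instance (k : ℕ) : DecidableEq (Idx k) := Classical.decEq _

lemma one_le_weight {k : ℕ} {α : ℝ} (hα : 0 ≤ α) (m : Mode k) : 1 ≤ weight α m.1 m.2 := by
  have h1 : ∀ ξ : Fin k → Freq, 1 ≤ ∏ j, bracket (ξ j) ^ α := fun ξ =>
    Finset.prod_induction _ (1 ≤ ·) (fun _ _ => one_le_mul_of_one_le_of_one_le) le_rfl
      fun j _ => Real.one_le_rpow (one_le_bracket _) hα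
  exact one_le_mul_of_one_le_of_one_le (h1 _) (h1 _)

lemma weight_pos {k : ℕ} (α : ℝ) (m : Mode k) : 0 < weight α m.1 m.2 :=
  mul_pos (Finset.prod_pos fun _ _ => Real.rpow_pos_of_pos (bracket_pos _) _)
    (Finset.prod_pos fun _ _ => Real.rpow_pos_of_pos (bracket_pos _) _)

/-- The isometry that sends the basis vector of index `(s, m)` to `W_s ⊗ e_m`. -/
def embedIsometry (hB : IsBernoulliFamily μ h) (k : ℕ) : LTwo (Idx k) →ₗᵢ[ℂ] RandomDM μ k :=
  (((orthonormal_tensor hB k).comp (fun i : Idx k => (i.1.1, i.2)) (by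
    rintro ⟨⟨s, hs⟩, m⟩ ⟨⟨t, ht⟩, m'⟩ h
    simpa using h)).orthogonalFamily).linearIsometry

lemma embedIsometry_single (hB : IsBernoulliFamily μ h) {k : ℕ} (i : Idx k) :
    embedIsometry hB k (lp.single 2 i (1 : ℂ)) = tensor hB i.1.1 i.2 := by
  rw [embedIsometry, OrthogonalFamily.linearIsometry_apply_single]
  simp

/-- Division by the Sobolev weight. -/
def unweight {α : ℝ} (hα : 0 ≤ α) (k : ℕ) : LTwo (Idx k) →L[ℂ] LTwo (Idx k) :=
  diagonal (fun i => ((weight α i.2.1 i.2.2)⁻¹ : ℝ)) fun i => by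
    rw [Complex.norm_real, Real.norm_of_nonneg (inv_nonneg.2 (weight_pos α i.2).le)]
    exact inv_le_one_of_one_le₀ (one_le_weight hα i.2)

/-- The random density matrix with given weighted coefficients. -/
def embed (hB : IsBernoulliFamily μ h) {α : ℝ} (hα : 0 ≤ α) (k : ℕ) :
    LTwo (Idx k) →L[ℂ] RandomDM μ k :=
  (embedIsometry hB k).toContinuousLinearMap.comp (unweight hα k)

lemma embed_single (hB : IsBernoulliFamily μ h) {α : ℝ} (hα : 0 ≤ α) {k : ℕ} (i : Idx k) :
    embed hB hα k (lp.single 2 i (1 : ℂ)) =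
      (((weight α i.2.1 i.2.2)⁻¹ : ℝ) : ℂ) • tensor hB i.1.1 i.2 := by
  rw [embed, ContinuousLinearMap.comp_apply, unweight, diagonal_single, map_smul]
  congr 1
  exact embedIsometry_single hB i

lemma coefL_embed_single (hB : IsBernoulliFamily μ h) {α : ℝ} (hα : 0 ≤ α) {k : ℕ} (m : Mode k)
    (i : Idx k) : coefL m (embed hB hα k (lp.single 2 i (1 : ℂ))) =
      if m = i.2 then (((weight α m.1 m.2)⁻¹ : ℝ) : ℂ) • walshLp hB 2 i.1.1 else 0 := by
  rw [embed_single, map_smul, coefL_tensor]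
  by_cases hm : m = i.2
  · rw [if_pos hm, if_pos hm, hm]
  · rw [if_neg hm, if_neg hm, smul_zero]

lemma coefL_embed (hB : IsBernoulliFamily μ h) {α : ℝ} (hα : 0 ≤ α) {k : ℕ} (m : Mode k)
    (f : LTwo (Idx k)) : coefL m (embed hB hα k f) =
      (((weight α m.1 m.2)⁻¹ : ℝ) : ℂ) • coefL m (embedIsometry hB k f) := by
  suffices H : (coefL m).comp (embed hB hα k) = (((weight α m.1 m.2)⁻¹ : ℝ) : ℂ) •
      (coefL m).comp (embedIsometry hB k).toContinuousLinearMap from DFunLike.congr_fun H f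
  refine LTwo.ext_single fun i => ?_
  rw [ContinuousLinearMap.comp_apply, coefL_embed_single]
  change _ = (((weight α m.1 m.2)⁻¹ : ℝ) : ℂ) • coefL m (embedIsometry hB k _)
  rw [embedIsometry_single, coefL_tensor]
  split_ifs <;> simp

lemma sobolevNorm_eq_of_hat {k : ℕ} {α : ℝ} {σ τ : DensityMatrix k} (hτ : ∀ m : Mode k,
    σ.hat m.1 m.2 = (((weight α m.1 m.2)⁻¹ : ℝ) : ℂ) * τ.hat m.1 m.2) :
    sobolevNorm α σ = ‖τ‖ₑ := by
  have h1 : sobolevNorm α σ = (‖τ‖ₑ ^ 2) ^ (1 / 2 : ℝ) := by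
    rw [sobolevNorm, enorm_sq_eq_tsum_hat]
    congr 1
    refine tsum_congr fun m => ?_
    have hw := weight_pos α m
    rw [hτ m, enorm_mul, ← mul_assoc]
    have : ENNReal.ofReal (weight α m.1 m.2) * ‖(((weight α m.1 m.2)⁻¹ : ℝ) : ℂ)‖ₑ = 1 := by
      rw [← ofReal_norm, Complex.norm_real, Real.norm_of_nonneg (inv_nonneg.2 hw.le),
        ← ENNReal.ofReal_mul hw.le, mul_inv_cancel₀ hw.ne', ENNReal.ofReal_one]
    rw [this, one_mul]
  rw [h1, ← ENNReal.rpow_natCast, ← ENNReal.rpow_mul]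
  norm_num

/-- The weights divided out by `embed` are those of the Sobolev norm, so for almost every `ω*` that
norm is the `L²` norm of the unweighted field; the latter is an isometric image of `f`. -/
lemma randomSobolevNorm_embed (hB : IsBernoulliFamily μ h) {α : ℝ} (hα : 0 ≤ α) {k : ℕ}
    (f : LTwo (Idx k)) : randomSobolevNorm α (embed hB hα k f) = ‖f‖ₑ := by
  have h0 := ae_all_iff.2 fun m : Mode k => coeFn_coefL m (embed hB hα k f)
  have h1 := ae_all_iff.2 fun m : Mode k => coeFn_coefL m (embedIsometry hB k f)
  have h2 := ae_all_iff.2 fun m : Mode k => Lp.coeFn_smul (((weight α m.1 m.2)⁻¹ : ℝ) : ℂ)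
    (coefL m (embedIsometry hB k f))
  have h3 : (fun ω => sobolevNorm α (embed hB hα k f ω)) =ᵐ[pStar μ]
      fun ω => ‖embedIsometry hB k f ω‖ₑ := by
    filter_upwards [h0, h1, h2] with ω e0 e1 e2
    refine sobolevNorm_eq_of_hat fun m => ?_
    rw [← e0 m, coefL_embed, e2 m, Pi.smul_apply, e1 m, smul_eq_mul]
  rw [randomSobolevNorm, eLpNorm_congr_ae h3, eLpNorm_enorm, ← Lp.enorm_def]
  simp [enorm_eq_nnnorm]

/-! ### Deterministic data -/

/-- The weighted coefficients of a deterministic density matrix. -/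
def constAmplitude {k : ℕ} (α : ℝ) (σ : DensityMatrix k) (i : Idx k) : ℂ :=
  if i.1.1 = ∅ then (weight α i.2.1 i.2.2 : ℂ) * σ.hat i.2.1 i.2.2 else 0

lemma tsum_constAmplitude {k : ℕ} (α : ℝ) (σ : DensityMatrix k) :
    ∑' i, ‖constAmplitude α σ i‖ₑ ^ 2 = sobolevNorm α σ ^ 2 := by
  rw [sobolevNorm, ← ENNReal.rpow_natCast, ← ENNReal.rpow_mul, ENNReal.tsum_prod']
  rw [tsum_eq_single ⟨∅, by simp⟩]
  · norm_num
    refine tsum_congr fun m => ?_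
    rw [constAmplitude, if_pos rfl, enorm_mul, ← ofReal_norm (weight α m.1 m.2 : ℂ),
      Complex.norm_real, Real.norm_of_nonneg (weight_pos α m).le]
  · intro s hs
    have : s.1 ≠ ∅ := fun h0 => hs (Subtype.ext h0)
    simp [constAmplitude, this]

/-- The element of the model space that corresponds to a deterministic density matrix. -/
def ofDensity {k : ℕ} {α : ℝ} (σ : DensityMatrix k) (hσ : sobolevNorm α σ < ∞) : LTwo (Idx k) :=
  ⟨constAmplitude α σ, memLTwo_iff.2 (by
    rw [tsum_constAmplitude]
    finiteness)⟩

lemma enorm_ofDensity {k : ℕ} {α : ℝ} (σ : DensityMatrix k) (hσ : sobolevNorm α σ < ∞) :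
    ‖ofDensity σ hσ‖ₑ = sobolevNorm α σ := by
  rw [← (ENNReal.pow_right_strictMono two_ne_zero).injective.eq_iff, LTwo.enorm_sq]
  exact tsum_constAmplitude α σ

/-- `W_∅ = 1`, and for each mode `m` only the index `(∅, m)` contributes to the Fourier coefficient.
-/
lemma embed_ofDensity (hB : IsBernoulliFamily μ h) {α : ℝ} (hα : 0 ≤ α) {k : ℕ}
    (σ : DensityMatrix k) (hσ : sobolevNorm α σ < ∞) :
    embed hB hα k (ofDensity σ hσ) = constRandom μ σ := by
  refine ext_coefL fun m => ?_
  have h1 := LTwo.hasSum_map ((coefL m).comp (embed hB hα k)) (ofDensity σ hσ)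
  have h2 := hasSum_single (f := fun i => ofDensity σ hσ i •
    ((coefL m).comp (embed hB hα k)) (lp.single 2 i (1 : ℂ))) (⟨∅, by simp⟩, m) (by
      rintro ⟨s, m'⟩ hi
      change constAmplitude α σ (s, m') • coefL m (embed hB hα k _) = 0
      rw [coefL_embed_single]
      split_ifs with hm
      · have : s.1 ≠ ∅ := fun h0 => hi (Prod.ext (Subtype.ext h0) hm.symm)
        simp [constAmplitude, this]
      · rw [smul_zero])
  have h3 := h1.unique h2
  rw [ContinuousLinearMap.comp_apply] at h3
  rw [h3]
  change constAmplitude α σ _ • coefL m (embed hB hα k _) = _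
  rw [coefL_embed_single, if_pos rfl, smul_smul]
  have hw : (weight α m.1 m.2 : ℂ) ≠ 0 := by exact_mod_cast (weight_pos α m).ne'
  have h4 : constAmplitude α σ (⟨∅, by simp⟩, m) * (((weight α m.1 m.2)⁻¹ : ℝ) : ℂ) =
      σ.hat m.1 m.2 := by
    rw [constAmplitude, if_pos rfl]
    push_cast
    field_simp
  rw [h4]
  refine Lp.ext ?_
  filter_upwards [Lp.coeFn_smul (σ.hat m.1 m.2) (walshLp hB 2 ∅), coeFn_walshLp hB 2 ∅,
    coeFn_coefL m (constRandom μ σ), Lp.coeFn_const (p := 2) (μ := pStar μ) (c := σ)]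
    with ω e1 e2 e3 e4
  have e4' : constRandom μ σ ω = σ := e4
  rw [e1, e3, e4', Pi.smul_apply, e2]
  simp [walsh]

/-! ### The free evolution on the model space -/

lemma freeEvolution_monomial {k : ℕ} (t : ℝ) (m : Mode k) :
    freeEvolution k t (monomial m) = phase k t (modeEquiv k m) • monomial m := by
  have hev : ∀ n, evolvedBasis k t n = phase k t n • monomialBasis k n := fun n => by
    simp [evolvedBasis]
  rw [monomial, ← hev, freeEvolution, LinearIsometryEquiv.trans_apply, HilbertBasis.repr_self,
    HilbertBasis.repr_symm_single]

/-- The free evolution of the weighted coefficients. -/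
def evolve (k : ℕ) (t : ℝ) : LTwo (Idx k) →L[ℂ] LTwo (Idx k) :=
  diagonal (fun i => phase k t (modeEquiv k i.2)) fun _ => (norm_phase k t _).le

lemma isContractionGroup_evolve (k : ℕ) : IsContractionGroup (evolve k) where
  norm_le t f := by
    refine (ContinuousLinearMap.le_opNorm _ _).trans ?_
    exact mul_le_of_le_one_left (norm_nonneg _) (norm_diagonal_le _ _)
  map_sub t s f := by
    ext i
    have hp : phase k (t - s) (modeEquiv k i.2) =
        phase k t (modeEquiv k i.2) * phase k (-s) (modeEquiv k i.2) := by
      simp only [phase]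
      rw [← Complex.exp_add]
      congr 1
      push_cast
      ring
    change phase k (t - s) (modeEquiv k i.2) * f i =
      phase k t (modeEquiv k i.2) * (phase k (-s) (modeEquiv k i.2) * f i)
    rw [hp, mul_assoc]
  continuous f := by
    refine continuous_diagonal _ _ (fun i => ?_) f
    unfold phase
    fun_prop

lemma randomFreeEvolution_embed (hB : IsBernoulliFamily μ h) {α : ℝ} (hα : 0 ≤ α) {k : ℕ} (t : ℝ)
    (f : LTwo (Idx k)) :
    randomFreeEvolution t (embed hB hα k f) = embed hB hα k (evolve k t f) := by
  suffices H : (((freeEvolution k t).toContinuousLinearEquiv :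
      DensityMatrix k →L[ℂ] DensityMatrix k).compLpL 2 (pStar μ)).comp (embed hB hα k) =
      (embed hB hα k).comp (evolve k t) from DFunLike.congr_fun H f
  refine LTwo.ext_single fun i => ?_
  rw [ContinuousLinearMap.comp_apply, ContinuousLinearMap.comp_apply, evolve, diagonal_single,
    map_smul, embed_single, map_smul, smul_comm]
  congr 1
  refine Lp.ext ?_
  filter_upwards [((freeEvolution k t).toContinuousLinearEquiv :
      DensityMatrix k →L[ℂ] DensityMatrix k).coeFn_compLpL (p := 2) (tensor hB i.1.1 i.2),
    coeFn_tensor hB i.1.1 i.2,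
    Lp.coeFn_smul (phase k t (modeEquiv k i.2)) (tensor hB i.1.1 i.2)] with ω e1 e2 e3
  rw [e3, Pi.smul_apply]
  refine e1.trans ?_
  rw [e2, map_smul, smul_comm]
  congr 1
  exact freeEvolution_monomial t i.2

end Random

/-! ### Collision kernels -/

/-- The sites of level `l` over a set of frequencies. -/
def atLevel (l : {k : ℕ // 2 ≤ k}) (D : Finset Freq) : Finset Site :=
  D.image fun ζ => (l, ζ)

@[simp] lemma mem_atLevel {l : {k : ℕ // 2 ≤ k}} {D : Finset Freq} {q : Site} :
    q ∈ atLevel l D ↔ q.1 = l ∧ q.2 ∈ D := by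
  obtain ⟨l', ζ⟩ := q
  simp only [atLevel, Finset.mem_image, Prod.mk.injEq]
  constructor
  · rintro ⟨_, hD, rfl, rfl⟩
    exact ⟨rfl, hD⟩
  · rintro ⟨rfl, hD⟩
    exact ⟨ζ, hD, rfl, rfl⟩

lemma atLevel_symmDiff (l : {k : ℕ // 2 ≤ k}) (D E : Finset Freq) :
    atLevel l (symmDiff D E) = symmDiff (atLevel l D) (atLevel l E) := by
  ext q
  simp only [mem_atLevel, Finset.mem_symmDiff]
  tauto

/-- The level `k + 1`. -/
def nextLevel {k : ℕ} (hk : 1 ≤ k) : {k : ℕ // 2 ≤ k} := ⟨k + 1, Nat.succ_le_succ hk⟩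

/-- The combinatorial data of one of the operators `B_{j,k+1}^±`: the mode of order `k + 1` that
contributes to a mode of order `k` through the pair `(a, b)`, the frequencies whose signs occur in
this contribution, and a uniform bound for the quotients of the weights. -/
structure CollisionKernel (k : ℕ) (α : ℝ) (C : ℝ≥0) where
  /-- The mode of order `k + 1` that contributes. -/
  modes : Mode k × (Freq × Freq) ≃ Mode (k + 1)
  /-- The frequencies whose signs occur. -/
  odd : Mode k × (Freq × Freq) → Finset Freq
  bound : ∀ n D, ∑' ab, {ab | odd (n, ab) = D}.indicator (fun ab => ENNReal.ofReal
    ((weight α n.1 n.2 / weight α (modes (n, ab)).1 (modes (n, ab)).2) ^ 2)) ab ≤ (C : ℝ≥0∞) ^ 2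

namespace CollisionKernel

variable {k : ℕ} {α : ℝ} {C : ℝ≥0} (K : CollisionKernel k α C) (hk : 1 ≤ k)

/-- The index that receives the contribution of a given index of order `k + 1`. -/
def target (i : Idx (k + 1)) : Idx k :=
  (⟨symmDiff i.1.1 (atLevel (nextLevel hk) (K.odd (K.modes.symm i.2))), fun q hq => by
    rcases Finset.mem_symmDiff.1 hq with ⟨h1, _⟩ | ⟨h1, _⟩
    · exact (Nat.lt_succ_self k).trans (i.1.2 q h1)
    · rw [(mem_atLevel.1 h1).1]
      exact Nat.lt_succ_self k⟩, (K.modes.symm i.2).1)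

/-- The quotient of the weights. -/
def coefficient (i : Idx (k + 1)) : ℂ :=
  ((weight α (K.modes.symm i.2).1.1 (K.modes.symm i.2).1.2 / weight α i.2.1 i.2.2 : ℝ) : ℂ)

/-- The patterns `s`, `t` have levels above `k + 1`, so the part of the symmetric difference at
level `k + 1` is exactly `D`. Here the freshness of `ω_{k+1}` enters. -/
lemma atLevel_injective {s t : Pattern (k + 1)} {D E : Finset Freq}
    (h : symmDiff s.1 (atLevel (nextLevel hk) D) = symmDiff t.1 (atLevel (nextLevel hk) E)) :
    s = t ∧ D = E := by
  have hs : ∀ (s : Pattern (k + 1)) ζ, (nextLevel hk, ζ) ∉ s.1 := fun s ζ hζ =>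
    lt_irrefl _ (s.2 _ hζ)
  have hD : D = E := by
    ext ζ
    have h1 : (nextLevel hk, ζ) ∈ symmDiff s.1 (atLevel (nextLevel hk) D) ↔
        (nextLevel hk, ζ) ∈ symmDiff t.1 (atLevel (nextLevel hk) E) := by rw [h]
    simpa [Finset.mem_symmDiff, hs] using h1
  subst hD
  exact ⟨Subtype.ext (symmDiff_left_injective _ h), rfl⟩

lemma fibreBound : FibreBound (K.target hk) K.coefficient C := by
  rintro ⟨r, n⟩
  by_cases hne : ∃ i, K.target hk i = (r, n)
  swap
  · push Not at hne
    simp [Set.indicator, hne]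
  obtain ⟨⟨s₀, m₀⟩, h₀⟩ := hne
  -- Over the fibre of `(r, n)` the pattern must be `s₀` and the receiving mode must be `n`; only
  -- the pairs `(a, b)` with a prescribed odd set remain.
  rw [ENNReal.tsum_prod', tsum_eq_single s₀]
  · rw [← K.modes.tsum_eq, ENNReal.tsum_prod', tsum_eq_single n]
    · refine le_trans (ENNReal.tsum_le_tsum fun ab => ?_)
        (K.bound n (K.odd (K.modes.symm m₀)))
      by_cases hab : K.target hk (s₀, K.modes (n, ab)) = (r, n)
      · have h1 : K.odd (n, ab) = K.odd (K.modes.symm m₀) := by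
          have h2 := congrArg (fun i : Idx k => i.1.1) (hab.trans h₀.symm)
          simpa using (atLevel_injective hk (s := s₀) (t := s₀) h2).2
        rw [Set.indicator_of_mem (by exact hab), Set.indicator_of_mem (by exact h1)]
        rw [coefficient, ← ofReal_norm, Complex.norm_real, ← ENNReal.ofReal_pow (norm_nonneg _),
          Real.norm_eq_abs, sq_abs]
        simp
      · rw [Set.indicator_of_notMem (by exact hab)]
        exact zero_le
    · intro n' hn'
      rw [ENNReal.tsum_eq_zero]
      intro ab
      refine Set.indicator_of_notMem (fun hmem => hn' ?_) _
      have : (K.target hk (s₀, K.modes (n', ab))).2 = n := congrArg Prod.snd hmem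
      simpa [target] using this
  · intro s hs
    rw [ENNReal.tsum_eq_zero]
    intro m
    refine Set.indicator_of_notMem (fun hmem => hs ?_) _
    have h1 : K.target hk (s, m) = (r, n) := hmem
    exact (atLevel_injective hk (congrArg (fun i : Idx k => i.1.1) (h1.trans h₀.symm))).1

/-- The collision operator on the model space. -/
def op : LTwo (Idx (k + 1)) →L[ℂ] LTwo (Idx k) := weightedPushforward (K.fibreBound hk)

lemma norm_op_le : ‖K.op hk‖ ≤ C := norm_weightedPushforward_le _

lemma op_single (i : Idx (k + 1)) : K.op hk (lp.single 2 i (1 : ℂ)) =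
    K.coefficient i • lp.single 2 (K.target hk i) (1 : ℂ) := by
  rw [op, weightedPushforward_single, coefficient, Complex.conj_ofReal]

section Random

variable {Ω : Type*} [MeasurableSpace Ω] {μ : Measure Ω} [IsProbabilityMeasure μ]
  {h : Freq → Ω → ℝ} (hB : IsBernoulliFamily μ h) (hα : 0 ≤ α)

lemma coefL_op_single (n : Mode k) (i : Idx (k + 1)) :
    coefL n (embed hB hα k (K.op hk (lp.single 2 i (1 : ℂ)))) =
      if n = (K.modes.symm i.2).1 then (((weight α i.2.1 i.2.2)⁻¹ : ℝ) : ℂ) •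
        walshLp hB 2 (symmDiff i.1.1 (atLevel (nextLevel hk) (K.odd (K.modes.symm i.2)))) else 0 := by
  rw [op_single, map_smul, map_smul, coefL_embed_single]
  by_cases hn : n = (K.modes.symm i.2).1
  · have hn' : n = (K.target hk i).2 := hn
    rw [if_pos hn', if_pos hn, smul_smul]
    congr 1
    rw [coefficient, ← hn, ← Complex.ofReal_mul]
    congr 1
    have := (weight_pos α n).ne'
    field_simp
  · have hn' : n ≠ (K.target hk i).2 := hn
    rw [if_neg hn', if_neg hn, smul_zero]

/-- The contribution of a pair of frequencies. -/
def termL (n : Mode k) (ab : Freq × Freq) : LTwo (Idx (k + 1)) →L[ℂ] Lp ℂ 2 (pStar μ) :=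
  (walshMul hB (atLevel (nextLevel hk) (K.odd (n, ab)))).comp
    ((coefL (K.modes (n, ab))).comp (embed hB hα (k + 1)))

lemma termL_single (n : Mode k) (ab : Freq × Freq) (i : Idx (k + 1)) :
    K.termL hk hB hα n ab (lp.single 2 i (1 : ℂ)) =
      if K.modes (n, ab) = i.2 then (((weight α i.2.1 i.2.2)⁻¹ : ℝ) : ℂ) •
        walshLp hB 2 (symmDiff i.1.1 (atLevel (nextLevel hk) (K.odd (K.modes.symm i.2)))) else 0 := by
  rw [termL, ContinuousLinearMap.comp_apply, ContinuousLinearMap.comp_apply, coefL_embed_single]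
  split_ifs with hm
  · rw [map_smul, walshMul_walshLp, ← hm, Equiv.symm_apply_apply]
  · rw [map_zero]

/-- Both sides expand over the basis vectors of `f`. The nonzero contributions are indexed by a pair
`(a, b)` and a pattern; summing over the patterns first gives the term of index `(a, b)`. -/
lemma hasSum_termL (n : Mode k) (f : LTwo (Idx (k + 1))) :
    HasSum (fun ab => K.termL hk hB hα n ab f) (coefL n (embed hB hα k (K.op hk f))) := by
  have h1 := LTwo.hasSum_map ((coefL n).comp ((embed hB hα k).comp (K.op hk))) f
  have hinj : Function.Injective
      fun p : (Freq × Freq) × Pattern (k + 1) => ((p.2, K.modes (n, p.1)) : Idx (k + 1)) := by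
    rintro ⟨ab, s⟩ ⟨ab', s'⟩ hp
    simpa [and_comm] using hp
  rw [← hinj.hasSum_iff] at h1
  · refine h1.prod_fiberwise fun ab => ?_
    have h2 := LTwo.hasSum_map (K.termL hk hB hα n ab) f
    have hinj2 : Function.Injective
        fun s : Pattern (k + 1) => ((s, K.modes (n, ab)) : Idx (k + 1)) := by
      intro s s' hp
      simpa using hp
    rw [← hinj2.hasSum_iff] at h2
    · refine h2.congr_fun fun s => ?_
      simp only [Function.comp_apply]
      congr 1
      refine (K.coefL_op_single hk hB hα n (s, K.modes (n, ab))).trans ?_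
      rw [termL_single]
      simp
    · rintro ⟨s, m⟩ hi
      rw [termL_single, if_neg, smul_zero]
      exact fun h0 => hi ⟨s, Prod.ext rfl h0⟩
  · rintro ⟨s, m⟩ hi
    have h3 := K.coefL_op_single hk hB hα n (s, m)
    rw [if_neg] at h3
    · have h4 : ((coefL n).comp ((embed hB hα k).comp (K.op hk)))
          (lp.single 2 (s, m) (1 : ℂ)) = 0 := h3
      rw [h4, smul_zero]
    · intro h0
      refine hi ⟨((K.modes.symm m).2, s), Prod.ext rfl ?_⟩
      have h0' : n = (K.modes.symm m).1 := h0
      rw [h0']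
      simp

lemma hasFourierSeries (f : LTwo (Idx (k + 1)))
    {term : (Fin k → Freq) → (Fin k → Freq) → Freq × Freq → OmegaStar Ω → ℂ}
    (hterm : ∀ (n : Mode k) ab, term n.1 n.2 ab =ᵐ[pStar μ] fun ω =>
      walsh h (atLevel (nextLevel hk) (K.odd (n, ab))) ω *
        DensityMatrix.hat (embed hB hα (k + 1) f ω) (K.modes (n, ab)).1 (K.modes (n, ab)).2) :
    HasFourierSeries term (embed hB hα k (K.op hk f)) := by
  intro ξ ξ'
  have h1 := K.hasSum_termL hk hB hα (ξ, ξ') f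
  rw [HasSum, SummationFilter.unconditional_filter, Lp.tendsto_Lp_iff_tendsto_eLpNorm'] at h1
  refine h1.congr fun F => eLpNorm_congr_ae ?_
  have h2 : ∀ ab, K.termL hk hB hα (ξ, ξ') ab f =ᵐ[pStar μ] term ξ ξ' ab := fun ab => by
    filter_upwards [coeFn_walshMul hB (atLevel (nextLevel hk) (K.odd ((ξ, ξ'), ab)))
      (coefL (K.modes ((ξ, ξ'), ab)) (embed hB hα (k + 1) f)),
      coeFn_coefL (K.modes ((ξ, ξ'), ab)) (embed hB hα (k + 1) f), hterm (ξ, ξ') ab]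
      with ω e1 e2 e3
    refine (e1.trans ?_).trans e3.symm
    rw [e2]
  filter_upwards [ae_all_iff.2 h2, coeFn_coefL (ξ, ξ') (embed hB hα k (K.op hk f)),
    Lp.coeFn_fun_finsetSum F (fun ab => K.termL hk hB hα (ξ, ξ') ab f)] with ω e1 e2 e3
  simp only [Pi.sub_apply]
  rw [e2, e3]
  simp only [e1]

end Random

end CollisionKernel

/-! ### The operators `B_{j,k+1}^±` -/

section Kernels

variable {k : ℕ}

/-- The mode of order `k + 1` that contributes to `B_{j,k+1}^+`. -/
def plusModes (j : Fin k) : Mode k × (Freq × Freq) ≃ Mode (k + 1) where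
  toFun p := (Fin.snoc (α := fun _ => Freq)
    (Function.update p.1.1 j (p.1.1 j - p.2.1 + p.2.2)) p.2.1,
    Fin.snoc (α := fun _ => Freq) p.1.2 p.2.2)
  invFun m := ((Function.update (Fin.init m.1) j
    (m.1 j.castSucc + m.1 (Fin.last k) - m.2 (Fin.last k)), Fin.init m.2),
    (m.1 (Fin.last k), m.2 (Fin.last k)))
  left_inv p := by
    obtain ⟨⟨ξ, ξ'⟩, a, b⟩ := p
    simp only [Fin.init_snoc, Fin.snoc_castSucc, Fin.snoc_last, Function.update_self,
      Function.update_idem]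
    rw [show ξ j - a + b + a - b = ξ j by abel, Function.update_eq_self]
  right_inv m := by
    obtain ⟨η, η'⟩ := m
    have h1 : η j.castSucc = Fin.init η j := rfl
    simp only [h1, Function.update_self, Function.update_idem]
    rw [show Fin.init η j + η (Fin.last k) - η' (Fin.last k) - η (Fin.last k) + η' (Fin.last k) =
      Fin.init η j by abel, Function.update_eq_self, Fin.snoc_init_self, Fin.snoc_init_self]

/-- The mode of order `k + 1` that contributes to `B_{j,k+1}^-`. -/
def minusModes (j : Fin k) : Mode k × (Freq × Freq) ≃ Mode (k + 1) :=
  ((Equiv.prodComm _ _).prodCongr (Equiv.prodComm _ _)).trans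
    ((plusModes j).trans (Equiv.prodComm _ _))

lemma weight_swap (α : ℝ) (ξ ξ' : Fin k → Freq) : weight α ξ ξ' = weight α ξ' ξ := mul_comm _ _

lemma prod_update (g : Freq → ℝ) (ξ : Fin k → Freq) (j : Fin k) (v : Freq) :
    (∏ i, g (Function.update ξ j v i)) * g (ξ j) = g v * ∏ i, g (ξ i) := by
  rw [← Finset.mul_prod_erase Finset.univ _ (Finset.mem_univ j),
    ← Finset.mul_prod_erase Finset.univ (fun i => g (ξ i)) (Finset.mem_univ j)]
  have : ∏ i ∈ Finset.univ.erase j, g (Function.update ξ j v i) =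
      ∏ i ∈ Finset.univ.erase j, g (ξ i) :=
    Finset.prod_congr rfl fun i hi => by
      rw [Function.update_of_ne (Finset.ne_of_mem_erase hi)]
  rw [this, Function.update_self]
  ring

/-- All slots other than `j` and the two new ones carry the same frequencies before and after the
collision and cancel. -/
lemma weight_div_plusModes (α : ℝ) (j : Fin k) (n : Mode k) (ab : Freq × Freq) :
    weight α n.1 n.2 / weight α (plusModes j (n, ab)).1 (plusModes j (n, ab)).2 =
      ratio α (n.1 j) ab := by
  obtain ⟨ξ, ξ'⟩ := n
  obtain ⟨a, b⟩ := ab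
  have hpos : ∀ ζ, 0 < bracket ζ ^ α := fun ζ => Real.rpow_pos_of_pos (bracket_pos ζ) α
  have h1 := prod_update (fun ζ => bracket ζ ^ α) ξ j (ξ j - a + b)
  have hb := fun ζ => (bracket_pos ζ).le
  have h2 : 0 < ∏ i, bracket (ξ i) ^ α := Finset.prod_pos fun _ _ => hpos _
  have h3 : 0 < ∏ i, bracket (ξ' i) ^ α := Finset.prod_pos fun _ _ => hpos _
  have h4 : 0 < ∏ i, bracket (Function.update ξ j (ξ j - a + b) i) ^ α :=
    Finset.prod_pos fun _ _ => hpos _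
  simp only [ratio, plusModes, Equiv.coe_fn_mk, weight, Fin.prod_univ_castSucc, Fin.snoc_castSucc,
    Fin.snoc_last]
  rw [Real.div_rpow (hb _) (mul_nonneg (mul_nonneg (hb _) (hb _)) (hb _)),
    Real.mul_rpow (mul_nonneg (hb _) (hb _)) (hb _), Real.mul_rpow (hb _) (hb _)]
  have p1 := hpos a
  have p2 := hpos b
  have p3 := hpos (ξ j)
  have p4 := hpos (ξ j - a + b)
  generalize ∏ i, bracket (ξ i) ^ α = X at *
  generalize ∏ i, bracket (ξ' i) ^ α = X' at *
  generalize ∏ i, bracket (Function.update ξ j (ξ j - a + b) i) ^ α = Y at *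
  generalize bracket (ξ j - a + b) ^ α = c at *
  generalize bracket a ^ α = u at *
  generalize bracket b ^ α = v at *
  generalize bracket (ξ j) ^ α = z at *
  rw [div_eq_div_iff (by positivity) (by positivity)]
  linear_combination (-(X' * u * v)) * h1

variable {α : ℝ} {C : ℝ≥0}

/-- The kernel of `B_{j,k+1}^+`. -/
def plusKernel (hC : ∀ (ζ : Freq) (D : Finset Freq), ∑' ab, {ab | oddFreqs ζ ab = D}.indicator
      (fun ab => ENNReal.ofReal (ratio α ζ ab ^ 2)) ab ≤ (C : ℝ≥0∞) ^ 2) (j : Fin k) :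
    CollisionKernel k α C where
  modes := plusModes j
  odd p := oddFreqs (p.1.1 j) p.2
  bound n D := by
    simp only [weight_div_plusModes]
    exact hC (n.1 j) D

/-- The kernel of `B_{j,k+1}^-`. -/
def minusKernel (hC : ∀ (ζ : Freq) (D : Finset Freq), ∑' ab, {ab | oddFreqs ζ ab = D}.indicator
      (fun ab => ENNReal.ofReal (ratio α ζ ab ^ 2)) ab ≤ (C : ℝ≥0∞) ^ 2) (j : Fin k) :
    CollisionKernel k α C where
  modes := minusModes j
  odd p := oddFreqs (p.1.2 j) p.2.swap
  bound n D := by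
    -- Exchanging primed and unprimed variables, and `a` with `b`, turns `B^-` into `B^+` and
    -- preserves the weights.
    have hw : ∀ ab, weight α n.1 n.2 / weight α (minusModes j (n, ab)).1 (minusModes j (n, ab)).2 =
        ratio α (n.2 j) ab.swap := fun ab => by
      rw [weight_swap, weight_swap α (minusModes j (n, ab)).1]
      exact weight_div_plusModes α j n.swap ab.swap
    simp only [hw]
    rw [← (Equiv.prodComm Freq Freq).tsum_eq]
    refine le_trans (le_of_eq ?_) (hC (n.2 j) D)
    exact tsum_congr fun ab => by simp [Set.indicator]

/-- The collision operator `B^{(k+1)}` on the model space. -/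
def collisionOp (hC : ∀ (ζ : Freq) (D : Finset Freq), ∑' ab, {ab | oddFreqs ζ ab = D}.indicator
      (fun ab => ENNReal.ofReal (ratio α ζ ab ^ 2)) ab ≤ (C : ℝ≥0∞) ^ 2) (hk : 1 ≤ k) :
    LTwo (Idx (k + 1)) →L[ℂ] LTwo (Idx k) :=
  ∑ j, ((plusKernel hC j).op hk - (minusKernel hC j).op hk)

variable (hC : ∀ (ζ : Freq) (D : Finset Freq), ∑' ab, {ab | oddFreqs ζ ab = D}.indicator
      (fun ab => ENNReal.ofReal (ratio α ζ ab ^ 2)) ab ≤ (C : ℝ≥0∞) ^ 2) (hk : 1 ≤ k)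

lemma norm_collisionOp_le : ‖collisionOp hC hk‖ ≤ 2 * C * k := by
  calc ‖collisionOp hC hk‖ ≤ ∑ _j : Fin k, (2 * C : ℝ) := by
        refine norm_sum_le_of_le _ fun j _ => (norm_sub_le _ _).trans ?_
        have h1 := (plusKernel hC j).norm_op_le hk
        have h2 := (minusKernel hC j).norm_op_le hk
        linarith
    _ = 2 * C * k := by simp; ring

variable {Ω : Type*} [MeasurableSpace Ω] {μ : Measure Ω} [IsProbabilityMeasure μ]
  {h : Freq → Ω → ℝ} (hB : IsBernoulliFamily μ h) (hα : 0 ≤ α)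

omit [MeasurableSpace Ω] in
-- Coinciding frequencies among the four contribute squares of signs, equal to `1`; so only the odd
-- ones are seen.
lemma walsh_atLevel_oddFreqs {l : {k : ℕ // 2 ≤ k}} {ω : OmegaStar Ω}
    (hω : ∀ p, sign h p ω * sign h p ω = 1) (ζ : Freq) (ab : Freq × Freq) :
    walsh h (atLevel l (oddFreqs ζ ab)) ω =
      ((h ζ (ω l) * h (ζ - ab.1 + ab.2) (ω l) * h ab.1 (ω l) * h ab.2 (ω l) : ℝ) : ℂ) := by
  have h1 : ∀ a : Freq, walsh h (atLevel l {a}) ω = ((h a (ω l) : ℝ) : ℂ) := fun a => by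
    simp [walsh, atLevel, sign]
  rw [oddFreqs, atLevel_symmDiff, ← walsh_mul_of_sq hω, atLevel_symmDiff, atLevel_symmDiff,
    ← walsh_mul_of_sq hω, ← walsh_mul_of_sq hω, h1, h1, h1, h1]
  push_cast
  ring

lemma isCollision_embed (f : LTwo (Idx (k + 1))) :
    IsCollision hk h (embed hB hα (k + 1) f) (embed hB hα k (collisionOp hC hk f)) := by
  refine ⟨fun j => embed hB hα k ((plusKernel hC j).op hk f),
    fun j => embed hB hα k ((minusKernel hC j).op hk f), fun j => ?_, fun j => ?_, ?_⟩
  · refine (plusKernel hC j).hasFourierSeries hk hB hα f fun n ab => ?_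
    filter_upwards [hB.ae_sign_sq] with ω hω
    have := walsh_atLevel_oddFreqs (l := nextLevel hk) hω (n.1 j) ab
    exact (congrArg (· * _) this).symm
  · refine (minusKernel hC j).hasFourierSeries hk hB hα f fun n ab => ?_
    filter_upwards [hB.ae_sign_sq] with ω hω
    have := walsh_atLevel_oddFreqs (l := nextLevel hk) hω (n.2 j) ab.swap
    refine Eq.trans ?_ (congrArg (· * _) this).symm
    simp only [minusTerm, Prod.fst_swap, Prod.snd_swap]
    rw [mul_right_comm _ (h ab.1 _) (h ab.2 _)]
    rfl
  · simp only [collisionOp, _root_.sum_apply, map_sum, _root_.sub_apply,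
      map_sub]

end Kernels

/-! ### The randomized hierarchy -/

lemma weight_mono {k : ℕ} {α β : ℝ} (h : α ≤ β) (m : Mode k) :
    weight α m.1 m.2 ≤ weight β m.1 m.2 := by
  have h1 : ∀ ξ : Fin k → Freq, ∏ j, bracket (ξ j) ^ α ≤ ∏ j, bracket (ξ j) ^ β := fun ξ =>
    Finset.prod_le_prod (fun j _ => Real.rpow_nonneg (bracket_pos _).le _) fun j _ =>
      Real.rpow_le_rpow_of_exponent_le (one_le_bracket _) h
  exact mul_le_mul (h1 _) (h1 _)
    (Finset.prod_nonneg fun j _ => Real.rpow_nonneg (bracket_pos _).le _)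
    (Finset.prod_nonneg fun j _ => Real.rpow_nonneg (bracket_pos _).le _)

lemma sobolevNorm_mono {k : ℕ} {α β : ℝ} (h : α ≤ β) (σ : DensityMatrix k) :
    sobolevNorm α σ ≤ sobolevNorm β σ := by
  unfold sobolevNorm
  gcongr with m
  exact weight_mono h m

lemma hierarchyNorm_mono {α β : ℝ} (h : α ≤ β) (ξ : ℝ) (Γ : DMSeq) :
    hierarchyNorm α ξ Γ ≤ hierarchyNorm β ξ Γ := by
  unfold hierarchyNorm
  gcongr with n
  exact sobolevNorm_mono h _

lemma sobolevNorm_lt_top_of_hierarchyNorm {α ξ : ℝ} (hξ : 0 < ξ) {Γ : DMSeq}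
    (h : hierarchyNorm α ξ Γ < ∞) (n : ℕ) : sobolevNorm α (Γ n) < ∞ := by
  have h1 := (ENNReal.le_tsum n).trans_lt h
  refine lt_top_iff_ne_top.2 fun h0 => ?_
  rw [h0, ENNReal.mul_top] at h1
  · exact lt_irrefl _ h1
  · simpa using pow_pos hξ (n + 1)

/-- The model of the initial data. -/
def initialAmplitude {α ξ : ℝ} (hξ : 0 < ξ) (Γ₀ : DMSeq) (h : hierarchyNorm α ξ Γ₀ < ∞) (n : ℕ) :
    LTwo (Idx (n + 1)) :=
  ofDensity (Γ₀ n) (sobolevNorm_lt_top_of_hierarchyNorm hξ h n)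

section Solution

variable {α ξ' : ℝ} (hξ' : 0 < ξ') (Γ₀ : DMSeq) (hΓ₀ : hierarchyNorm α ξ' Γ₀ < ∞)

lemma hierarchyNorm_eq_tsum : hierarchyNorm α ξ' Γ₀ =
    ∑' n, ENNReal.ofReal (ξ' ^ (n + 1) * ‖initialAmplitude hξ' Γ₀ hΓ₀ n‖) := by
  refine tsum_congr fun n => ?_
  rw [ENNReal.ofReal_mul (by positivity), ofReal_norm, initialAmplitude, enorm_ofDensity]

lemma summable_initialAmplitude :
    Summable fun n => ξ' ^ (n + 1) * ‖initialAmplitude hξ' Γ₀ hΓ₀ n‖ := by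
  have h := hΓ₀.ne
  rw [hierarchyNorm_eq_tsum hξ' Γ₀ hΓ₀] at h
  have h2 := ENNReal.summable_toReal h
  refine h2.congr fun n => ?_
  exact ENNReal.toReal_ofReal (by positivity)

lemma ofReal_tsum_initialAmplitude :
    ENNReal.ofReal (∑' n, ξ' ^ (n + 1) * ‖initialAmplitude hξ' Γ₀ hΓ₀ n‖) =
      hierarchyNorm α ξ' Γ₀ := by
  rw [hierarchyNorm_eq_tsum hξ' Γ₀ hΓ₀,
    ENNReal.ofReal_tsum_of_nonneg (fun n => by positivity) (summable_initialAmplitude hξ' Γ₀ hΓ₀)]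

variable {C : ℝ≥0}
  (hC : ∀ (ζ : Freq) (D : Finset Freq), ∑' ab, {ab | oddFreqs ζ ab = D}.indicator
    (fun ab => ENNReal.ofReal (ratio α ζ ab ^ 2)) ab ≤ (C : ℝ≥0∞) ^ 2)

/-- The collision operators on the model spaces. -/
abbrev modelCollision (n : ℕ) : LTwo (Idx (n + 1 + 1)) →L[ℂ] LTwo (Idx (n + 1)) :=
  collisionOp hC (Nat.succ_pos n)

/-- The solution on the model spaces. -/
def amplitude (n : ℕ) (t : ℝ) : LTwo (Idx (n + 1)) :=
  duhamelPath (H := fun n => LTwo (Idx (n + 1))) (fun n => evolve (n + 1)) (modelCollision hC)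
    (initialAmplitude hξ' Γ₀ hΓ₀) n t

/-- Index `n` stores order `n + 1`, so the collision operator into it has norm at most `2 C (n +
1)`. The abstract condition on the time, with constant `2 C`, becomes `4 C T ≤ ξ'`. -/
lemma isSummableHierarchy_model {T : ℝ} (hT : 0 ≤ T) (hCT : 4 * C * T ≤ ξ') :
    IsSummableHierarchy (H := fun n => LTwo (Idx (n + 1))) (fun n => evolve (n + 1))
      (modelCollision hC) (initialAmplitude hξ' Γ₀ hΓ₀) (2 * C) ξ' T where
  group n := isContractionGroup_evolve (n + 1)
  nonneg := by positivity
  norm_le n := (norm_collisionOp_le hC _).trans_eq (by push_cast; ring)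
  pos := hξ'
  time_nonneg := hT
  time_le := by linarith
  summable := summable_initialAmplitude hξ' Γ₀ hΓ₀

variable {T : ℝ} {ξ : ℝ}

lemma pow_mul_norm_amplitude_le (hT : 0 ≤ T) (hCT : 4 * C * T ≤ ξ') (hξ : 0 < ξ) (hξξ' : ξ < ξ')
    (n : ℕ) {t : ℝ} (ht : t ∈ Icc 0 T) :
    ξ ^ (n + 1) * ‖amplitude hξ' Γ₀ hΓ₀ hC n t‖ ≤
      (2 * ξ / ξ') ^ n * ∑' k, ξ' ^ (k + 1) * ‖initialAmplitude hξ' Γ₀ hΓ₀ k‖ := by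
  have h1 := (isSummableHierarchy_model hξ' Γ₀ hΓ₀ hC hT hCT).norm_path_le n ht
  set A := ∑' k, ξ' ^ (k + 1) * ‖initialAmplitude hξ' Γ₀ hΓ₀ k‖
  have hA : 0 ≤ A := tsum_nonneg fun k => by positivity
  calc ξ ^ (n + 1) * ‖amplitude hξ' Γ₀ hΓ₀ hC n t‖
      ≤ ξ ^ (n + 1) * (2 ^ n / ξ' ^ (n + 1) * A) := by
        refine mul_le_mul_of_nonneg_left h1 (by positivity)
    _ = (ξ / ξ') * ((2 * ξ / ξ') ^ n * A) := by
        rw [div_pow, mul_pow, pow_succ, pow_succ]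
        field_simp
    _ ≤ 1 * ((2 * ξ / ξ') ^ n * A) := by
        have : ξ / ξ' ≤ 1 := (div_le_one hξ').2 hξξ'.le
        gcongr
    _ = _ := one_mul _

variable {Ω : Type*} [MeasurableSpace Ω] {μ : Measure Ω} [IsProbabilityMeasure μ]
  {h : Freq → Ω → ℝ} (hB : IsBernoulliFamily μ h) (hα : 0 ≤ α)

/-- The solution of the randomized hierarchy. -/
def solution (t : ℝ) : RandomDMSeq μ := fun n =>
  embed hB hα (n + 1) (amplitude hξ' Γ₀ hΓ₀ hC n t)

/-- The collision operator applied to the solution. -/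
def solutionCollision (t : ℝ) : RandomDMSeq μ := fun n =>
  embed hB hα (n + 1) (modelCollision hC n (amplitude hξ' Γ₀ hΓ₀ hC (n + 1) t))

lemma randomHierarchyNorm_solution_le (hT : 0 ≤ T) (hCT : 4 * C * T ≤ ξ') (hξ : 0 < ξ)
    (hξξ' : ξ < ξ') (h2 : 2 * ξ / ξ' < 1) {t : ℝ} (ht : t ∈ Icc 0 T) :
    randomHierarchyNorm α ξ (solution hξ' Γ₀ hΓ₀ hC hB hα t) ≤
      (Real.toNNReal (1 - 2 * ξ / ξ')⁻¹ : ℝ≥0∞) * hierarchyNorm α ξ' Γ₀ := by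
  have h0 : 0 ≤ 2 * ξ / ξ' := by positivity
  calc randomHierarchyNorm α ξ (solution hξ' Γ₀ hΓ₀ hC hB hα t)
      = ∑' n, ENNReal.ofReal (ξ ^ (n + 1) * ‖amplitude hξ' Γ₀ hΓ₀ hC n t‖) := by
        refine tsum_congr fun n => ?_
        rw [solution, randomSobolevNorm_embed, ENNReal.ofReal_mul (by positivity), ofReal_norm]
    _ ≤ ∑' n, ENNReal.ofReal ((2 * ξ / ξ') ^ n) * hierarchyNorm α ξ' Γ₀ := by
        refine ENNReal.tsum_le_tsum fun n => ?_
        rw [← ofReal_tsum_initialAmplitude hξ' Γ₀ hΓ₀, ← ENNReal.ofReal_mul (by positivity)]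
        exact ENNReal.ofReal_le_ofReal
          (pow_mul_norm_amplitude_le hξ' Γ₀ hΓ₀ hC hT hCT hξ hξξ' n ht)
    _ = _ := by
        rw [ENNReal.tsum_mul_right, ← ENNReal.ofReal_tsum_of_nonneg (fun n => by positivity)
          (summable_geometric_of_lt_one h0 h2), tsum_geometric_of_lt_one h0 h2]
        rfl

lemma continuousOn_amplitude (hT : 0 ≤ T) (hCT : 4 * C * T ≤ ξ') (n : ℕ) :
    ContinuousOn (amplitude hξ' Γ₀ hΓ₀ hC n) (Icc 0 T) :=
  (isSummableHierarchy_model hξ' Γ₀ hΓ₀ hC hT hCT).continuousOn_path n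

/-- Every component is continuous, and the geometric bound with ratio `2 ξ / ξ'`, uniform in time,
allows dominated convergence in the sum over orders. -/
lemma isContinuousInTime_solution (hT : 0 ≤ T) (hCT : 4 * C * T ≤ ξ') (hξ : 0 < ξ)
    (hξξ' : ξ < ξ') (h2 : 2 * ξ / ξ' < 1) :
    IsContinuousInTime T α ξ (solution hξ' Γ₀ hΓ₀ hC hB hα) := by
  have h0 : 0 ≤ 2 * ξ / ξ' := by positivity
  refine ⟨fun t ht => (randomHierarchyNorm_solution_le hξ' Γ₀ hΓ₀ hC hB hα hT hCT hξ hξξ' h2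
    ht).trans_lt (by finiteness), fun t₀ ht₀ => ?_⟩
  set A := ∑' k, ξ' ^ (k + 1) * ‖initialAmplitude hξ' Γ₀ hΓ₀ k‖ with hA
  have hbd : ∀ n, ∀ t ∈ Icc 0 T,
      ξ ^ (n + 1) * ‖amplitude hξ' Γ₀ hΓ₀ hC n t - amplitude hξ' Γ₀ hΓ₀ hC n t₀‖ ≤
        (2 * ξ / ξ') ^ n * (2 * A) := fun n t ht => by
    have e1 := pow_mul_norm_amplitude_le hξ' Γ₀ hΓ₀ hC hT hCT hξ hξξ' n ht
    have e2 := pow_mul_norm_amplitude_le hξ' Γ₀ hΓ₀ hC hT hCT hξ hξξ' n ht₀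
    have e3 := mul_le_mul_of_nonneg_left
      (norm_sub_le (amplitude hξ' Γ₀ hΓ₀ hC n t) (amplitude hξ' Γ₀ hΓ₀ hC n t₀))
      (by positivity : 0 ≤ ξ ^ (n + 1))
    linarith
  have hsum : Summable fun n => (2 * ξ / ξ') ^ n * (2 * A) :=
    (summable_geometric_of_lt_one h0 h2).mul_right _
  have hreal : Tendsto (fun t => ∑' n, ξ ^ (n + 1) *
      ‖amplitude hξ' Γ₀ hΓ₀ hC n t - amplitude hξ' Γ₀ hΓ₀ hC n t₀‖) (𝓝[Icc 0 T] t₀)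
      (𝓝 (∑' _n : ℕ, (0 : ℝ))) := by
    refine tendsto_tsum_of_dominated_convergence hsum (fun n => ?_) ?_
    · have e1 := tendsto_iff_norm_sub_tendsto_zero.1
        (continuousOn_amplitude hξ' Γ₀ hΓ₀ hC hT hCT n t₀ ht₀)
      simpa using e1.const_mul (ξ ^ (n + 1))
    · filter_upwards [self_mem_nhdsWithin] with t ht n
      rw [Real.norm_of_nonneg (by positivity)]
      exact hbd n t ht
  rw [tsum_zero] at hreal
  have hE := ENNReal.tendsto_ofReal hreal
  rw [ENNReal.ofReal_zero] at hE
  refine hE.congr' ?_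
  filter_upwards [self_mem_nhdsWithin] with t ht
  rw [ENNReal.ofReal_tsum_of_nonneg (fun n => by positivity)
    (hsum.of_nonneg_of_le (fun n => by positivity) fun n => hbd n t ht)]
  refine tsum_congr fun n => ?_
  have e1 : (solution hξ' Γ₀ hΓ₀ hC hB hα t - solution hξ' Γ₀ hΓ₀ hC hB hα t₀) n =
      embed hB hα (n + 1) (amplitude hξ' Γ₀ hΓ₀ hC n t - amplitude hξ' Γ₀ hΓ₀ hC n t₀) := by
    rw [map_sub]
    rfl
  rw [e1, randomSobolevNorm_embed, ENNReal.ofReal_mul (by positivity), ofReal_norm]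

lemma continuousOn_modelCollision (hT : 0 ≤ T) (hCT : 4 * C * T ≤ ξ') (n : ℕ) :
    ContinuousOn (fun s => modelCollision hC n (amplitude hξ' Γ₀ hΓ₀ hC (n + 1) s)) (Icc 0 T) :=
  (modelCollision hC n).continuous.comp_continuousOn
    (continuousOn_amplitude hξ' Γ₀ hΓ₀ hC hT hCT (n + 1))

lemma intervalIntegrable_evolve (hT : 0 ≤ T) (hCT : 4 * C * T ≤ ξ') (n : ℕ) {t : ℝ}
    (ht : t ∈ Icc 0 T) : IntervalIntegrable (fun s => evolve (n + 1) (t - s)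
      (modelCollision hC n (amplitude hξ' Γ₀ hΓ₀ hC (n + 1) s))) volume 0 t := by
  refine ContinuousOn.intervalIntegrable ?_
  rw [Set.uIcc_of_le ht.1]
  exact (isContractionGroup_evolve (n + 1)).continuousOn_apply (by fun_prop)
    ((continuousOn_modelCollision hξ' Γ₀ hΓ₀ hC hT hCT n).mono (Icc_subset_Icc_right ht.2))

lemma isCollisionPath_solution (hT : 0 ≤ T) (hCT : 4 * C * T ≤ ξ') :
    IsCollisionPath h T α (solution hξ' Γ₀ hΓ₀ hC hB hα)
      (solutionCollision hξ' Γ₀ hΓ₀ hC hB hα) := by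
  refine ⟨fun t _ n => isCollision_embed hC (Nat.succ_pos n) hB hα _, fun t ht n => ?_,
    fun n => ?_⟩
  · simp only [solutionCollision, randomFreeEvolution_embed]
    have hint := intervalIntegrable_evolve hξ' Γ₀ hΓ₀ hC hT hCT n ht
    exact ⟨(embed hB hα (n + 1)).integrable_comp hint.1,
      (embed hB hα (n + 1)).integrable_comp hint.2⟩
  · simp only [solutionCollision, randomSobolevNorm_embed]
    exact ((continuousOn_modelCollision hξ' Γ₀ hΓ₀ hC hT hCT n).integrableOn_compact
      isCompact_Icc).2

/-- The Duhamel identity on the model space is carried over by `embed`, which commutes with the free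
evolution and with the integral. -/
lemma duhamelDefect_solution (hT : 0 ≤ T) (hCT : 4 * C * T ≤ ξ') {t : ℝ} (ht : t ∈ Icc 0 T) :
    duhamelDefect Γ₀ (solution hξ' Γ₀ hΓ₀ hC hB hα) (solutionCollision hξ' Γ₀ hΓ₀ hC hB hα) t =
      0 := by
  ext1 n
  have h1 : constRandom μ (freeEvolution (n + 1) t (Γ₀ n)) =
      embed hB hα (n + 1) (evolve (n + 1) t (initialAmplitude hξ' Γ₀ hΓ₀ n)) := by
    rw [← randomFreeEvolution_embed, initialAmplitude, embed_ofDensity]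
    refine Lp.ext ?_
    filter_upwards [((freeEvolution (n + 1) t).toContinuousLinearEquiv :
        DensityMatrix (n + 1) →L[ℂ] DensityMatrix (n + 1)).coeFn_compLp (constRandom μ (Γ₀ n)),
      Lp.coeFn_const (p := 2) (μ := pStar μ) (c := Γ₀ n),
      Lp.coeFn_const (p := 2) (μ := pStar μ) (c := freeEvolution (n + 1) t (Γ₀ n))]
      with ω e1 e2 e3
    refine Eq.trans e3 (Eq.trans ?_ e1.symm)
    have e2' : constRandom μ (Γ₀ n) ω = Γ₀ n := e2
    rw [e2']
    rfl
  have h2 : ∫ s in (0 : ℝ)..t,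
      randomFreeEvolution (t - s) (solutionCollision hξ' Γ₀ hΓ₀ hC hB hα s n) =
      embed hB hα (n + 1) (∫ s in (0 : ℝ)..t, evolve (n + 1) (t - s)
        (modelCollision hC n (amplitude hξ' Γ₀ hΓ₀ hC (n + 1) s))) := by
    rw [← ContinuousLinearMap.intervalIntegral_comp_comm _
      (intervalIntegrable_evolve hξ' Γ₀ hΓ₀ hC hT hCT n ht)]
    simp only [solutionCollision, randomFreeEvolution_embed]
  have h3 := (isSummableHierarchy_model hξ' Γ₀ hΓ₀ hC hT hCT).duhamel_eq n ht
  rw [duhamelDefect, h1, h2, solution, ← map_smul, ← map_sub, ← map_add]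
  have h4 : amplitude hξ' Γ₀ hΓ₀ hC n t - evolve (n + 1) t (initialAmplitude hξ' Γ₀ hΓ₀ n) +
      Complex.I • ∫ s in (0 : ℝ)..t, evolve (n + 1) (t - s)
        (modelCollision hC n (amplitude hξ' Γ₀ hΓ₀ hC (n + 1) s)) = 0 := by
    have h5 : amplitude hξ' Γ₀ hΓ₀ hC n t = evolve (n + 1) t (initialAmplitude hξ' Γ₀ hΓ₀ n) -
      Complex.I • ∫ s in (0 : ℝ)..t, evolve (n + 1) (t - s)
        (modelCollision hC n (amplitude hξ' Γ₀ hΓ₀ hC (n + 1) s)) := h3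
    rw [h5]
    abel
  rw [h4, map_zero]
  rfl

include hB hα in
lemma randomSobolevNorm_zero (n : ℕ) : randomSobolevNorm α (0 : RandomDM μ n) = 0 := by
  have := randomSobolevNorm_embed hB hα (0 : LTwo (Idx n))
  simpa using this

end Solution

end RandomGP

end

/-! ### The theorem and the choice of constants -/

theorem theorem3p16 :
    ∃ C₂ : ℝ, 0 < C₂ ∧
    ∀ α α₀ : ℝ, 3 / 4 < α → α < α₀ →
    ∃ C₁ : ℝ, 0 < C₁ ∧
    ∀ ξ ξ' : ℝ, 0 < ξ → ξ < ξ' → C₂ * ξ / ξ' < 1 →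
    ∃ M : ℝ≥0,
    ∀ T : ℝ, 0 < T → C₁ * T / ξ' < 1 →
    ∀ (Ω : Type*) [MeasurableSpace Ω] (μ : Measure Ω) [IsProbabilityMeasure μ]
      (h : RandomGP.Freq → Ω → ℝ), RandomGP.IsBernoulliFamily μ h →
    ∀ Γ₀ : RandomGP.DMSeq, RandomGP.hierarchyNorm α₀ ξ' Γ₀ < ∞ →
    ∃ Γ β : ℝ → RandomGP.RandomDMSeq μ,
      RandomGP.IsContinuousInTime T α ξ Γ ∧
      RandomGP.IsCollisionPath h T α Γ β ∧
      (∀ t ∈ Icc 0 T, ∀ ξ₀ : ℝ, 0 < ξ₀ →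
        RandomGP.randomHierarchyNorm α ξ₀ (RandomGP.duhamelDefect Γ₀ Γ β t) = 0) ∧
      (∀ t ∈ Icc 0 T, ∀ n : ℕ,
        RandomGP.randomSobolevNorm α (RandomGP.duhamelDefect Γ₀ Γ β t n) = 0) ∧
      RandomGP.linftyHierarchyNorm T α ξ Γ ≤ M * RandomGP.hierarchyNorm α ξ' Γ₀ := by
  -- The `2` is the base of the bound on the binomial coefficients; it makes `2 ξ / ξ'` the ratio of
  -- the geometric series over the orders.
  refine ⟨2, two_pos, fun α α₀ hα hα₀ => ?_⟩
  obtain ⟨C, hC0, hC⟩ := RandomGP.exists_tsum_ratio_le hα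
  -- In `4 C`, one factor `2` counts `B^+` and `B^-`, the other bounds the binomial coefficients.
  -- `M` is the sum of the geometric series.
  refine ⟨4 * C, by positivity, fun ξ ξ' hξ hξξ' h2 => ⟨Real.toNNReal (1 - 2 * ξ / ξ')⁻¹,
    fun T hT hCT Ω _ μ _ h hB Γ₀ hΓ₀ => ?_⟩⟩
  have hξ' : 0 < ξ' := hξ.trans hξξ'
  have hα0 : 0 ≤ α := by linarith
  have hCT' : 4 * C * T ≤ ξ' := ((div_lt_one hξ').1 hCT).le
  have hΓ : RandomGP.hierarchyNorm α ξ' Γ₀ < ∞ :=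
    (RandomGP.hierarchyNorm_mono hα₀.le ξ' Γ₀).trans_lt hΓ₀
  have hdef : ∀ t ∈ Icc 0 T, ∀ n : ℕ, RandomGP.randomSobolevNorm α
      (RandomGP.duhamelDefect Γ₀ (RandomGP.solution hξ' Γ₀ hΓ hC hB hα0)
        (RandomGP.solutionCollision hξ' Γ₀ hΓ hC hB hα0) t n) = 0 := fun t ht n => by
    rw [RandomGP.duhamelDefect_solution hξ' Γ₀ hΓ hC hB hα0 hT.le hCT' ht]
    exact RandomGP.randomSobolevNorm_zero hB hα0 (n + 1)
  refine ⟨RandomGP.solution hξ' Γ₀ hΓ hC hB hα0, RandomGP.solutionCollision hξ' Γ₀ hΓ hC hB hα0,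
    RandomGP.isContinuousInTime_solution hξ' Γ₀ hΓ hC hB hα0 hT.le hCT' hξ hξξ' h2,
    RandomGP.isCollisionPath_solution hξ' Γ₀ hΓ hC hB hα0 hT.le hCT', fun t ht ξ₀ _ => ?_, hdef, ?_⟩
  · simp [RandomGP.randomHierarchyNorm, hdef t ht]
  · refine essSup_le_of_ae_le _ ?_
    filter_upwards [ae_restrict_mem measurableSet_Icc] with t ht
    exact RandomGP.randomHierarchyNorm_solution_le hξ' Γ₀ hΓ hC hB hα0 hT.le hCT' hξ hξξ' h2 ht
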